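/- Setting. Let $R$ be a commutative $\mathbb{C}$-algebra and let $(\mathcal{C},\otimes,\gamma)$ be a symmetric strict monoidal category enriched over cochain complexes of $R$-modules concentrated in degrees $-1,0$ (composition and $\otimes$ being morphisms for the truncated tensor product of complexes, and $\gamma$ being 2-natural). Let $t:\otimes\Rightarrow\otimes$ be a symmetric strict infinitesimal 2-braiding, i.e. a pseudonatural transformation, with components $t_{UV}$ and homotopies $t_f$, such that $t=\gamma^{-1}t_\tau\gamma$ (where $t_\tau$ has components $t_{VU}$) and $t_{1(23)}=t_{12}+t_{13}$, $t_{(12)3}=t_{23}+t_{13}$ as pseudonatural endomorphisms of $\otimes^2:(U,V,W)\mapsto U\otimes V\otimes W$. Here $t_{12}=t\otimes 1$, $t_{23}=1\otimes t$, $t_{13}$ is $t_{23}$ conjugated by the symmetric braiding of the first two factors, and $t_{(12)3}$, $t_{1(23)}$ have components $t_{U\otimes V,W}$, $t_{U,V\otimes W}$. Let $\mathcal{L}=t_{t_{12}}:[t_{12},t_{(12)3}]\Rrightarrow 0$ and $\mathcal{R}=t_{t_{23}}:[t_{23},t_{1(23)}]\Rrightarrow 0$ be the modifications obtained by evaluating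 the homotopies of $t$ on $t_{UV}\otimes 1$, respectively on $1\otimes t_{VW}$, and put $\Lambda=t_{12}+t_{23}+t_{13}$. The Cirio–Martins–Knizhnik–Zamolodchikov 2-connection on the space of triples $(z_1,z_2,z_3)$ of distinct complex numbers is given, with $\omega_{ij}=\frac{d(z_i-z_j)}{z_i-z_j}$, by $A=\hbar\sum_{i<j}\omega_{ij}t_{ij}$ and $\Delta=2\hbar^2(\omega_{12}\wedge\omega_{31}\,\mathcal{L}+\omega_{23}\wedge\omega_{31}\,\mathcal{R})$, with the convention $(\alpha\wedge\beta)[X,Y]=\frac12(\alpha(X)\beta(Y)-\alpha(Y)\beta(X))$. In the coordinates $(z_1,z_2,z_3)=(w,zv+w,v+w)$, on $w=0$, it reads $A=\hbar\big(t_{12}\frac{dz}{z}+t_{23}\frac{dz}{z-1}+\Lambda\frac{dv}{v}\big)$, $\Delta=2\hbar^2\big(\frac{\mathcal{L}}{zv}+\frac{\mathcal{R}}{(z-1)v}\big)dz\wedge dv$. For a 2-path $P:[0,1]^2\to\mathbb{C}^2$, $(s,r)\mapsto P^s(r)=P(s,r)$, in the $(z,v)$-plane, its 2-holonomy is $$W^{P}=\int_0^1\int_0^1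 W^{P^s}_{1r}\,\Delta[\partial_sP,\partial_rP]\,W^{P^s}_{r0}\,dr\,ds ,$$ where $W^{p}_{ba}$ is the parallel transport, i.e. the solution of $\partial_bW^p_{ba}=A[p'(b)]W^p_{ba}$, $W^p_{aa}=1$, as a series of iterated integrals. It is a formal power series in $\hbar$ with coefficients in the module of endomodifications-to-$0$ of $\otimes^2$ (pairs of a pseudonatural endomorphism $\xi$ of $\otimes^2$ and a modification $\xi\Rrightarrow 0$); $(W^P)_n$ denotes the coefficient of $\hbar^n$. Fix $a\in\mathbb{C}\setminus\{0\}$ and let $0<\varepsilon\le\frac14$. Put $c_{I}(s)=\varepsilon+s(1-2\varepsilon)$, $\hat c_V(s)=1-\frac{1}{1-c_I(s)}$, $c_{III}(s)=\frac1{1-c_I(s)}$, $c_{IV}(s)=\frac12+\big(\frac1\varepsilon-\frac12\big)e^{-i\pi s}$ and $h(x)=\frac{1-c_I(x)}{1-\varepsilon}\,a$. The 2-path $P_V$ is $$P_V(s,r)=\begin{cases}(\hat c_V(2r),a)& 0\le r\le \frac s2,\\ (\hat c_V(s),h(2r-s))&\frac s2\le r\le s,\\ (\hat c_V(r),h(r))&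 s\le r\le 1,\end{cases}$$ $P_{III}$ is given by the same formula with $c_{III}$ instead of $\hat c_V$, and $$P_{IV}(s,r)=\begin{cases}(c_{IV}(2r),a)& 0\le r\le \frac s2,\\ (c_{IV}(s),h(2r-s))&\frac s2\le r\le \frac{1+s}2,\\ (c_{IV}(2r-1),h(1))& \frac{1+s}2\le r\le 1.\end{cases}$$ Let also $f_V(s)$ be the series $$\sum_{q\ge0,\,k\ge1}\ \sum_{i_1,\dots,i_q\in\{0,1\}}\ \sum_{j=0}^{k-1}\int_\varepsilon^{c_I(s)}\Omega_{i_1}D_{i_1}\cdots\Omega_{i_q}D_{i_q}\,\Lambda^j\big[\Omega_0\Omega_1^k\mathcal{L}-\Omega_1^{k+1}(\mathcal{L}+\mathcal{R})\big]\Lambda^{k-1-j},$$ with $\Omega_0=\frac{dx}{x}$, $\Omega_1=\frac{dx}{x-1}$, iterated integrals $\int_a^b\omega_1\cdots\omega_n=\int_a^b\omega_1(x)\int_a^x\omega_2\cdots\omega_n$, $D_0=\mathrm{ad}_{t_{12}}$ and $D_1(\Xi)=[t_{13}-\Lambda,\Xi]+\Lambda\Xi$; its general term has order $q+k+1$ in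 $\hbar$. Statement. The coefficients of order $0$ and $1$ in $\hbar$ of $W^{P_V}$, $f_V(1)$, $W^{P_{III}}$ and $W^{P_{IV}}$ vanish, and as $\varepsilon\to0^+$ the coefficients of order $2$ satisfy $$(W^{P_V})_2=-\frac{\pi^2}{6}\mathcal{L}-\frac{(\ln\varepsilon)^2}{2}(\mathcal{L}+\mathcal{R})+o(1),\qquad (f_V(1))_2=-\frac{\pi^2}{6}\mathcal{L}-\frac{(\ln\varepsilon)^2}{2}(\mathcal{L}+\mathcal{R})+o(1),$$ $$(W^{P_{III}})_2=-\frac{\pi^2}{6}\mathcal{R}-\frac{(\ln\varepsilon)^2}{2}(\mathcal{L}+\mathcal{R})+o(1),\qquad (W^{P_{IV}})_2=-i\pi(\ln\varepsilon)(\mathcal{L}+\mathcal{R})+o(1),$$ where $o(1)$ denotes a function of $\varepsilon$ that tends to $0$ in the module of endomodifications-to-$0$ with its canonical complex-linear topology (the finest one making addition and scalar multiplication continuous; it is the usual topology in finite dimensions). -/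

import Mathlib

open scoped TensorProduct Topology
open TensorProduct

universe w u u' u'' v v' v''

/-! ## Cochain 2-categories

A `ChCat R C` is a category with object type `C` enriched over cochain complexes of `R`-modules
concentrated in degrees `-1` and `0`.  `H0 U V` and `H1 U V` are the components of degree `0` and
`-1` of the hom complex.  A composite of two elements of degree `-1` has degree `-2`, hence is zero;
the Leibniz rule for it is the axiom `trunc`. -/

class ChCat (R : Type w) [CommRing R] (C : Type u) where
  H0 : C → C → Type v
  H1 : C → C → Type v
  [acg0 : ∀ U V, AddCommGroup (H0 U V)]
  [acg1 : ∀ U V, AddCommGroup (H1 U V)]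
  [mod0 : ∀ U V, Module R (H0 U V)]
  [mod1 : ∀ U V, Module R (H1 U V)]
  d : ∀ {U V : C}, H1 U V →ₗ[R] H0 U V
  one : ∀ U : C, H0 U U
  c00 : ∀ {U V W : C}, H0 V W →ₗ[R] H0 U V →ₗ[R] H0 U W
  c01 : ∀ {U V W : C}, H0 V W →ₗ[R] H1 U V →ₗ[R] H1 U W
  c10 : ∀ {U V W : C}, H1 V W →ₗ[R] H0 U V →ₗ[R] H1 U W
  assoc000 : ∀ {U V W X : C} (h : H0 W X) (g : H0 V W) (f : H0 U V),
    c00 (c00 h g) f = c00 h (c00 g f)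
  assoc001 : ∀ {U V W X : C} (h : H0 W X) (g : H0 V W) (k : H1 U V),
    c01 (c00 h g) k = c01 h (c01 g k)
  assoc010 : ∀ {U V W X : C} (h : H0 W X) (k : H1 V W) (f : H0 U V),
    c10 (c01 h k) f = c01 h (c10 k f)
  assoc100 : ∀ {U V W X : C} (k : H1 W X) (g : H0 V W) (f : H0 U V),
    c10 (c10 k g) f = c10 k (c00 g f)
  one_c00 : ∀ {U V : C} (f : H0 U V), c00 (one V) f = f
  c00_one : ∀ {U V : C} (f : H0 U V), c00 f (one U) = f
  one_c01 : ∀ {U V : C} (k : H1 U V), c01 (one V) k = k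
  c10_one : ∀ {U V : C} (k : H1 U V), c10 k (one U) = k
  d_c01 : ∀ {U V W : C} (g : H0 V W) (k : H1 U V), d (c01 g k) = c00 g (d k)
  d_c10 : ∀ {U V W : C} (k : H1 V W) (f : H0 U V), d (c10 k f) = c00 (d k) f
  trunc : ∀ {U V W : C} (k : H1 V W) (l : H1 U V), c01 (d k) l = c10 k (d l)

namespace ChCat
attribute [reducible, instance] acg0 acg1 mod0 mod1

variable {R : Type w} [CommRing R] {C : Type u} [ChCat.{w, u, v} R C]

/-- The identity morphism regarded as a morphism between two equal objects. -/
def eqHom (R : Type w) [CommRing R] {C : Type u} [ChCat.{w, u, v} R C] {U V : C} (h : U = V) :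
    H0 R U V := h ▸ one U

end ChCat

open ChCat

/-! ## Functors between cochain 2-categories -/

structure ChFunctor (R : Type w) [CommRing R] (B : Type u) [ChCat.{w, u, v} R B]
    (C : Type u') [ChCat.{w, u', v'} R C] where
  obj : B → C
  map0 : ∀ {U V : B}, H0 R U V →ₗ[R] H0 R (obj U) (obj V)
  map1 : ∀ {U V : B}, H1 R U V →ₗ[R] H1 R (obj U) (obj V)
  map_d : ∀ {U V : B} (k : H1 R U V), map0 (d k) = d (map1 k)
  map_one : ∀ U : B, map0 (one U) = one (obj U)
  map_c00 : ∀ {U V W : B} (g : H0 R V W) (f : H0 R U V), map0 (c00 g f) = c00 (map0 g) (map0 f)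
  map_c01 : ∀ {U V W : B} (g : H0 R V W) (k : H1 R U V), map1 (c01 g k) = c01 (map0 g) (map1 k)
  map_c10 : ∀ {U V W : B} (k : H1 R V W) (f : H0 R U V), map1 (c10 k f) = c10 (map1 k) (map0 f)

namespace ChFunctor

section
variable {R : Type w} [CommRing R] {B : Type u} [ChCat.{w, u, v} R B]
  {C : Type u'} [ChCat.{w, u', v'} R C] {D : Type u''} [ChCat.{w, u'', v''} R D]

def id (R : Type w) [CommRing R] (B : Type u) [ChCat.{w, u, v} R B] : ChFunctor R B B where
  obj U := U
  map0 := LinearMap.id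
  map1 := LinearMap.id
  map_d _ := rfl
  map_one _ := rfl
  map_c00 _ _ := rfl
  map_c01 _ _ := rfl
  map_c10 _ _ := rfl

def comp (G : ChFunctor R C D) (F : ChFunctor R B C) : ChFunctor R B D where
  obj U := G.obj (F.obj U)
  map0 := G.map0 ∘ₗ F.map0
  map1 := G.map1 ∘ₗ F.map1
  map_d k := by simp [F.map_d, G.map_d]
  map_one U := by simp [F.map_one, G.map_one]
  map_c00 g f := by simp [F.map_c00, G.map_c00]
  map_c01 g f := by simp [F.map_c01, G.map_c01]
  map_c10 g f := by simp [F.map_c10, G.map_c10]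

theorem ext_of_obj {F G : ChFunctor R B C} (hobj : F.obj = G.obj)
    (h0 : ∀ U V, HEq (@map0 _ _ _ _ _ _ F U V) (@map0 _ _ _ _ _ _ G U V))
    (h1 : ∀ U V, HEq (@map1 _ _ _ _ _ _ F U V) (@map1 _ _ _ _ _ _ G U V)) : F = G := by
  obtain ⟨Fo, F0, F1, _, _, _, _, _⟩ := F
  obtain ⟨Go, G0, G1, _, _, _, _, _⟩ := G
  obtain rfl : Fo = Go := hobj
  obtain rfl : @F0 = @G0 := by
    funext U V
    exact eq_of_heq (h0 U V)
  obtain rfl : @F1 = @G1 := by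
    funext U V
    exact eq_of_heq (h1 U V)
  rfl

end
end ChFunctor

/-! ## The monoidal product `⊠` of cochain 2-categories

Objects of `Box C D` are pairs.  Hom complexes are the tensor products of hom complexes, truncated to
degrees `[-1,0]`: the part of degree `-1` is the cokernel of the differential coming from degree
`-2`.  No Koszul sign occurs in these degrees except in that differential. -/

section Box

variable {R : Type w} [CommRing R]

theorem map₂_assoc {M₁ M₂ M₃ M₁₂ M₂₃ P N₁ N₂ N₃ N₁₂ N₂₃ Q : Type*}
    [AddCommGroup M₁] [AddCommGroup M₂] [AddCommGroup M₃] [AddCommGroup M₁₂] [AddCommGroup M₂₃]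
    [AddCommGroup P] [AddCommGroup N₁] [AddCommGroup N₂] [AddCommGroup N₃] [AddCommGroup N₁₂]
    [AddCommGroup N₂₃] [AddCommGroup Q]
    [Module R M₁] [Module R M₂] [Module R M₃] [Module R M₁₂] [Module R M₂₃] [Module R P]
    [Module R N₁] [Module R N₂] [Module R N₃] [Module R N₁₂] [Module R N₂₃] [Module R Q]
    {f : M₁₂ →ₗ[R] M₃ →ₗ[R] P} {g : M₁ →ₗ[R] M₂ →ₗ[R] M₁₂}
    {h : M₁ →ₗ[R] M₂₃ →ₗ[R] P} {k : M₂ →ₗ[R] M₃ →ₗ[R] M₂₃}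
    {f' : N₁₂ →ₗ[R] N₃ →ₗ[R] Q} {g' : N₁ →ₗ[R] N₂ →ₗ[R] N₁₂}
    {h' : N₁ →ₗ[R] N₂₃ →ₗ[R] Q} {k' : N₂ →ₗ[R] N₃ →ₗ[R] N₂₃}
    (e : ∀ x y z, f (g x y) z = h x (k y z)) (e' : ∀ x y z, f' (g' x y) z = h' x (k' y z))
    (x : M₁ ⊗[R] N₁) (y : M₂ ⊗[R] N₂) (z : M₃ ⊗[R] N₃) :
    map₂ f f' (map₂ g g' x y) z = map₂ h h' x (map₂ k k' y z) := by
  induction x with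
  | zero => simp
  | add a b ha hb => simp only [map_add, LinearMap.add_apply, ha, hb]
  | tmul a b =>
    induction y with
    | zero => simp
    | add a b ha hb => simp only [map_add, LinearMap.add_apply, ha, hb]
    | tmul a b =>
      induction z with
      | zero => simp
      | add a b ha hb => simp only [map_add, ha, hb]
      | tmul a b => simp [e, e']

abbrev Box (C : Type u) (D : Type u') : Type (max u u') := C × D

variable {C : Type u} [ChCat.{w, u, v} R C] {D : Type u'} [ChCat.{w, u', v'} R D]

namespace Box

variable (R) in
/-- The tensor product of two hom complexes in degree `-1`, before truncation. -/
abbrev Pre1 (X Y : C × D) : Type (max v v') :=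
  (H1 R X.1 Y.1 ⊗[R] H0 R X.2 Y.2) × (H0 R X.1 Y.1 ⊗[R] H1 R X.2 Y.2)

variable (R) in
/-- The differential from degree `-2` to degree `-1`: `k ⊗ l ↦ ∂k ⊗ l - k ⊗ ∂l`. -/
def rel (X Y : C × D) : (H1 R X.1 Y.1 ⊗[R] H1 R X.2 Y.2) →ₗ[R] Pre1 R X Y :=
  LinearMap.prod (-(LinearMap.lTensor _ d)) (LinearMap.rTensor _ d)

variable (R) in
abbrev Hom1 (X Y : C × D) : Type (max v v') := Pre1 R X Y ⧸ LinearMap.range (rel R X Y)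

/-- The class of an element of degree `-1` of the tensor product. -/
abbrev cls {X Y : C × D} (p : Pre1 R X Y) : Hom1 R X Y := Submodule.Quotient.mk p

theorem cls_rel {X Y : C × D} (k : H1 R X.1 Y.1) (l : H1 R X.2 Y.2) :
    (cls ((k ⊗ₜ d l, 0) : Pre1 R X Y)) = cls ((0, d k ⊗ₜ l) : Pre1 R X Y) := by
  refine (Submodule.Quotient.eq _).2 ⟨-(k ⊗ₜ l), ?_⟩
  simp [rel]

theorem hom1_ind {X Y : C × D} {P : Hom1 R X Y → Prop} (q : Hom1 R X Y)
    (hadd : ∀ a b, P a → P b → P (a + b))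
    (hl : ∀ (k : H1 R X.1 Y.1) (g : H0 R X.2 Y.2), P (cls (k ⊗ₜ g, 0)))
    (hr : ∀ (f : H0 R X.1 Y.1) (l : H1 R X.2 Y.2), P (cls (0, f ⊗ₜ l))) : P q := by
  have h1 : ∀ x, P (cls ((x, 0) : Pre1 R X Y)) := by
    intro x
    induction x with
    | zero => simpa using hl 0 0
    | add a b ha hb =>
      have := hadd _ _ ha hb
      rwa [← Submodule.Quotient.mk_add, Prod.mk_add_mk, add_zero] at this
    | tmul a b => exact hl a b
  have h2 : ∀ x, P (cls ((0, x) : Pre1 R X Y)) := by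
    intro x
    induction x with
    | zero => simpa using hr 0 0
    | add a b ha hb =>
      have := hadd _ _ ha hb
      rwa [← Submodule.Quotient.mk_add, Prod.mk_add_mk, add_zero] at this
    | tmul a b => exact hr a b
  induction q using Submodule.Quotient.induction_on with
  | _ p =>
    obtain ⟨a, b⟩ := p
    have := hadd _ _ (h1 a) (h2 b)
    rwa [← Submodule.Quotient.mk_add, Prod.mk_add_mk, add_zero, zero_add] at this

def pre01 {X Y Z : C × D} (x : H0 R Y.1 Z.1 ⊗[R] H0 R Y.2 Z.2) : Pre1 R X Y →ₗ[R] Pre1 R X Z :=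
  LinearMap.prodMap (map₂ c01 c00 x) (map₂ c00 c01 x)

def pre10 {X Y Z : C × D} (x : H0 R X.1 Y.1 ⊗[R] H0 R X.2 Y.2) : Pre1 R Y Z →ₗ[R] Pre1 R X Z :=
  LinearMap.prodMap ((map₂ c10 c00).flip x) ((map₂ c00 c10).flip x)

theorem pre01_rel {X Y Z : C × D} (x : H0 R Y.1 Z.1 ⊗[R] H0 R Y.2 Z.2)
    (y : H1 R X.1 Y.1 ⊗[R] H1 R X.2 Y.2) :
    pre01 x (rel R X Y y) = rel R X Z (map₂ c01 c01 x y) := by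
  induction x with
  | zero => simp [pre01]
  | add a b ha hb => simp only [pre01, map_add, LinearMap.add_apply, LinearMap.prodMap_add] at *
                     rw [ha, hb]
  | tmul a b =>
    induction y with
    | zero => simp
    | add a b ha hb => simp only [map_add, ha, hb]
    | tmul k l => simp [pre01, rel, d_c01]

theorem pre10_rel {X Y Z : C × D} (x : H0 R X.1 Y.1 ⊗[R] H0 R X.2 Y.2)
    (y : H1 R Y.1 Z.1 ⊗[R] H1 R Y.2 Z.2) :
    pre10 x (rel R Y Z y) = rel R X Z (map₂ c10 c10 y x) := by
  induction x with
  | zero => simp [pre10]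
  | add a b ha hb => simp only [pre10, map_add, LinearMap.add_apply, LinearMap.prodMap_add] at *
                     rw [ha, hb]
  | tmul a b =>
    induction y with
    | zero => simp
    | add a b ha hb => simp only [map_add, ha, hb, LinearMap.add_apply]
    | tmul k l => simp [pre10, rel, d_c10]

def comp01 {X Y Z : C × D} :
    (H0 R Y.1 Z.1 ⊗[R] H0 R Y.2 Z.2) →ₗ[R] Hom1 R X Y →ₗ[R] Hom1 R X Z :=
  LinearMap.mk₂ R
    (fun x => Submodule.mapQ _ _ (pre01 x) (by rintro _ ⟨y, rfl⟩; exact ⟨_, (pre01_rel x y).symm⟩))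
    (fun x y q => by
      induction q using Submodule.Quotient.induction_on with
      | _ p => simp [pre01, ← Submodule.Quotient.mk_add])
    (fun c x q => by
      induction q using Submodule.Quotient.induction_on with
      | _ p => simp [pre01, ← Submodule.Quotient.mk_smul])
    (fun x q q' => map_add _ q q')
    (fun c x q => map_smul _ c q)

def comp10 {X Y Z : C × D} :
    Hom1 R Y Z →ₗ[R] (H0 R X.1 Y.1 ⊗[R] H0 R X.2 Y.2) →ₗ[R] Hom1 R X Z :=
  LinearMap.flip <| LinearMap.mk₂ R
    (fun x => Submodule.mapQ _ _ (pre10 x) (by rintro _ ⟨y, rfl⟩; exact ⟨_, (pre10_rel x y).symm⟩))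
    (fun x y q => by
      induction q using Submodule.Quotient.induction_on with
      | _ p => simp [pre10, ← Submodule.Quotient.mk_add])
    (fun c x q => by
      induction q using Submodule.Quotient.induction_on with
      | _ p => simp [pre10, ← Submodule.Quotient.mk_smul])
    (fun x q q' => map_add _ q q')
    (fun c x q => map_smul _ c q)

theorem comp01_cls {X Y Z : C × D} (x : H0 R Y.1 Z.1 ⊗[R] H0 R Y.2 Z.2) (a) (b) :
    comp01 x (cls ((a, b) : Pre1 R X Y)) = cls (map₂ c01 c00 x a, map₂ c00 c01 x b) := rfl

theorem comp10_cls {X Y Z : C × D} (x : H0 R X.1 Y.1 ⊗[R] H0 R X.2 Y.2) (a) (b) :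
    comp10 (cls ((a, b) : Pre1 R Y Z)) x = cls (map₂ c10 c00 a x, map₂ c00 c10 b x) := rfl

/-- The differential from degree `-1` to degree `0`. -/
def diff {X Y : C × D} : Hom1 R X Y →ₗ[R] H0 R X.1 Y.1 ⊗[R] H0 R X.2 Y.2 :=
  Submodule.liftQ _ (LinearMap.coprod (LinearMap.rTensor _ d) (LinearMap.lTensor _ d)) (by
    rintro _ ⟨y, rfl⟩
    rw [LinearMap.mem_ker]
    induction y with
    | zero => simp
    | add a b ha hb => rw [map_add, map_add, ha, hb, add_zero]
    | tmul k l => simp [rel])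

theorem diff_cls {X Y : C × D} (a) (b) :
    diff (cls ((a, b) : Pre1 R X Y)) = LinearMap.rTensor _ d a + LinearMap.lTensor _ d b := rfl

end Box

open Box in
instance Box.chCat : ChCat.{w, max u u', max v v'} R (Box C D) where
  H0 X Y := H0 R X.1 Y.1 ⊗[R] H0 R X.2 Y.2
  H1 X Y := Hom1 R (C := C) (D := D) X Y
  d := diff
  one X := one X.1 ⊗ₜ one X.2
  c00 := map₂ c00 c00
  c01 := comp01
  c10 := comp10
  assoc000 := map₂_assoc assoc000 assoc000
  assoc001 h g q := by
    induction q using Submodule.Quotient.induction_on with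
    | _ p =>
      obtain ⟨a, b⟩ := p
      simp only [comp01_cls, map₂_assoc assoc001 assoc000, map₂_assoc assoc000 assoc001]
  assoc010 h q f := by
    induction q using Submodule.Quotient.induction_on with
    | _ p =>
      obtain ⟨a, b⟩ := p
      simp only [comp01_cls, comp10_cls, map₂_assoc assoc010 assoc000,
        map₂_assoc assoc000 assoc010]
  assoc100 q g f := by
    induction q using Submodule.Quotient.induction_on with
    | _ p =>
      obtain ⟨a, b⟩ := p
      simp only [comp10_cls, map₂_assoc assoc100 assoc000, map₂_assoc assoc000 assoc100]
  one_c00 f := by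
    induction f with
    | zero => simp
    | add a b ha hb => rw [map_add, ha, hb]
    | tmul k l => simp [one_c00]
  c00_one f := by
    induction f with
    | zero => simp
    | add a b ha hb => rw [map_add, LinearMap.add_apply, ha, hb]
    | tmul k l => simp [c00_one]
  one_c01 q := by
    induction q using hom1_ind with
    | hadd a b ha hb => rw [map_add, ha, hb]
    | hl k g => simp [comp01_cls, one_c00, one_c01]
    | hr k g => simp [comp01_cls, one_c00, one_c01]
  c10_one q := by
    induction q using hom1_ind with
    | hadd a b ha hb => rw [map_add, LinearMap.add_apply, ha, hb]
    | hl k g => simp [comp10_cls, c00_one, c10_one]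
    | hr k g => simp [comp10_cls, c00_one, c10_one]
  d_c01 x q := by
    induction q using hom1_ind with
    | hadd a b ha hb => simp only [map_add, ha, hb]
    | hl k g =>
      induction x with
      | zero => simp
      | add a b ha hb => simp only [map_add, LinearMap.add_apply, ha, hb]
      | tmul a b => simp [comp01_cls, diff_cls, d_c01]
    | hr k g =>
      induction x with
      | zero => simp
      | add a b ha hb => simp only [map_add, LinearMap.add_apply, ha, hb]
      | tmul a b => simp [comp01_cls, diff_cls, d_c01]
  d_c10 q x := by
    induction q using hom1_ind with
    | hadd a b ha hb => simp only [map_add, LinearMap.add_apply, ha, hb]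
    | hl k g =>
      induction x with
      | zero => simp
      | add a b ha hb => simp only [map_add, ha, hb]
      | tmul a b => simp [comp10_cls, diff_cls, d_c10]
    | hr k g =>
      induction x with
      | zero => simp
      | add a b ha hb => simp only [map_add, ha, hb]
      | tmul a b => simp [comp10_cls, diff_cls, d_c10]
  trunc p q := by
    induction p using hom1_ind with
    | hadd a b ha hb => simp only [map_add, LinearMap.add_apply, ha, hb]
    | hl k g =>
      induction q using hom1_ind with
      | hadd a b ha hb => simp only [map_add, ha, hb]
      | hl k' g' => simp [comp01_cls, comp10_cls, diff_cls, trunc]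
      | hr f l =>
        simp only [comp01_cls, comp10_cls, diff_cls, LinearMap.rTensor_tmul, map_zero, add_zero,
          zero_add, LinearMap.lTensor_tmul, map₂_apply_tmul, LinearMap.zero_apply,
          TensorProduct.map_tmul]
        rw [← d_c10, ← cls_rel, d_c01]
    | hr f l =>
      induction q using hom1_ind with
      | hadd a b ha hb => simp only [map_add, ha, hb]
      | hl k' g' =>
        simp only [comp01_cls, comp10_cls, diff_cls, LinearMap.rTensor_tmul, map_zero, add_zero,
          zero_add, LinearMap.lTensor_tmul, map₂_apply_tmul, LinearMap.zero_apply,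
          TensorProduct.map_tmul]
        rw [← d_c10, cls_rel, d_c01]
      | hr k' g' => simp [comp01_cls, comp10_cls, diff_cls, trunc]

end Box

namespace Box
section

variable {R : Type w} [CommRing R] {C : Type u} [ChCat.{w, u, v} R C]
  {D : Type u'} [ChCat.{w, u', v'} R D] {U U' U'' : C} {V V' V'' : D}

/-- `f ⊠ g` for `f`, `g` of degree `0`. -/
def tm : H0 R U U' →ₗ[R] H0 R V V' →ₗ[R] H0 R ((U, V) : Box C D) (U', V') :=
  TensorProduct.mk R _ _

/-- `k ⊠ g` for `k` of degree `-1` and `g` of degree `0`. -/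
def inL : H1 R U U' →ₗ[R] H0 R V V' →ₗ[R] H1 R ((U, V) : Box C D) (U', V') :=
  (TensorProduct.mk R (H1 R U U') (H0 R V V')).compr₂
    (Submodule.mkQ (LinearMap.range (rel R (U, V) (U', V'))) ∘ₗ LinearMap.inl R _ _)

/-- `f ⊠ l` for `f` of degree `0` and `l` of degree `-1`. -/
def inR : H0 R U U' →ₗ[R] H1 R V V' →ₗ[R] H1 R ((U, V) : Box C D) (U', V') :=
  (TensorProduct.mk R (H0 R U U') (H1 R V V')).compr₂
    (Submodule.mkQ (LinearMap.range (rel R (U, V) (U', V'))) ∘ₗ LinearMap.inr R _ _)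

theorem ind0 {P : H0 R ((U, V) : Box C D) (U', V') → Prop} (x)
    (hadd : ∀ a b, P a → P b → P (a + b)) (h : ∀ a b, P (tm a b)) : P x := by
  refine TensorProduct.induction_on (motive := P) x ?_ h hadd
  have := h 0 0
  rwa [map_zero] at this

theorem ind1 {P : H1 R ((U, V) : Box C D) (U', V') → Prop} (x)
    (hadd : ∀ a b, P a → P b → P (a + b)) (hl : ∀ k g, P (inL k g)) (hr : ∀ f l, P (inR f l)) :
    P x := hom1_ind (P := P) x hadd hl hr

theorem inL_d (k : H1 R U U') (l : H1 R V V') :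
    (inL k (d l) : H1 R ((U, V) : Box C D) (U', V')) = inR (d k) l :=
  cls_rel (X := (U, V)) (Y := (U', V')) k l

theorem one_def {U : C} {V : D} : (one (U, V) : H0 R ((U, V) : Box C D) (U, V)) = tm (one U) (one V) := rfl

theorem d_inL (k : H1 R U U') (g : H0 R V V') :
    d (inL k g : H1 R ((U, V) : Box C D) (U', V')) = tm (d k) g := by
  change LinearMap.rTensor _ d (k ⊗ₜ[R] g) + LinearMap.lTensor _ d 0 = d k ⊗ₜ[R] g
  simp

theorem d_inR (f : H0 R U U') (l : H1 R V V') :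
    d (inR f l : H1 R ((U, V) : Box C D) (U', V')) = tm f (d l) := by
  change LinearMap.rTensor _ d 0 + LinearMap.lTensor _ d (f ⊗ₜ[R] l) = f ⊗ₜ[R] d l
  simp

theorem tm_tm (f' : H0 R U' U'') (g' : H0 R V' V'') (f : H0 R U U') (g : H0 R V V') :
    c00 (tm f' g' : H0 R ((U', V') : Box C D) (U'', V'')) (tm f g) = tm (c00 f' f) (c00 g' g) :=
  rfl

theorem tm_inL (f' : H0 R U' U'') (g' : H0 R V' V'') (f : H1 R U U') (g : H0 R V V') :
    c01 (tm f' g' : H0 R ((U', V') : Box C D) (U'', V'')) (inL f g) = inL (c01 f' f) (c00 g' g) := by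
  change cls (map₂ c01 c00 (f' ⊗ₜ[R] g') (f ⊗ₜ[R] g), map₂ c00 c01 (f' ⊗ₜ[R] g') 0) =
    cls ((c01 f' f ⊗ₜ[R] c00 g' g, 0) : Pre1 R (U, V) (U'', V''))
  simp

theorem tm_inR (f' : H0 R U' U'') (g' : H0 R V' V'') (f : H0 R U U') (g : H1 R V V') :
    c01 (tm f' g' : H0 R ((U', V') : Box C D) (U'', V'')) (inR f g) = inR (c00 f' f) (c01 g' g) := by
  change cls (map₂ c01 c00 (f' ⊗ₜ[R] g') 0, map₂ c00 c01 (f' ⊗ₜ[R] g') (f ⊗ₜ[R] g)) =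
    cls ((0, c00 f' f ⊗ₜ[R] c01 g' g) : Pre1 R (U, V) (U'', V''))
  simp

theorem inL_tm (f' : H1 R U' U'') (g' : H0 R V' V'') (f : H0 R U U') (g : H0 R V V') :
    c10 (inL f' g' : H1 R ((U', V') : Box C D) (U'', V'')) (tm f g) = inL (c10 f' f) (c00 g' g) := by
  change cls (map₂ c10 c00 (f' ⊗ₜ[R] g') (f ⊗ₜ[R] g), map₂ c00 c10 0 (f ⊗ₜ[R] g)) =
    cls ((c10 f' f ⊗ₜ[R] c00 g' g, 0) : Pre1 R (U, V) (U'', V''))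
  simp

theorem inR_tm (f' : H0 R U' U'') (g' : H1 R V' V'') (f : H0 R U U') (g : H0 R V V') :
    c10 (inR f' g' : H1 R ((U', V') : Box C D) (U'', V'')) (tm f g) = inR (c00 f' f) (c10 g' g) := by
  change cls (map₂ c10 c00 0 (f ⊗ₜ[R] g), map₂ c00 c10 (f' ⊗ₜ[R] g') (f ⊗ₜ[R] g)) =
    cls ((0, c00 f' f ⊗ₜ[R] c10 g' g) : Pre1 R (U, V) (U'', V''))
  simp


section Whisker

variable {W W' : C}

theorem boxOne0 {a : H0 R U W} {a' : H0 R U' W'} {f : H0 R U U'} {f' : H0 R W W'} {g : H0 R V V'}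
    {k : H1 R U W'} {x : H0 R ((W, V) : Box C D) (W', V')} {y : H0 R ((U, V) : Box C D) (U', V')}
    (hx : x = tm f' g) (hy : y = tm f g) (h : c00 f' a - c00 a' f = d k) :
    c00 x (tm a (one V) : H0 R ((U, V) : Box C D) (W, V)) -
      c00 (tm a' (one V') : H0 R ((U', V') : Box C D) (W', V')) y = d (inL k g) := by
  subst hx hy
  rw [tm_tm, tm_tm, d_inL, ← h, one_c00, c00_one, map_sub, LinearMap.sub_apply]

theorem boxOneL {a : H0 R U W} {a' : H0 R U' W'} {f : H1 R U U'} {f' : H1 R W W'} {g : H0 R V V'}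
    {k : H1 R U W'} {x : H1 R ((W, V) : Box C D) (W', V')} {y : H1 R ((U, V) : Box C D) (U', V')}
    (hx : x = inL f' g) (hy : y = inL f g) (h : c10 f' a - c01 a' f = k) :
    c10 x (tm a (one V) : H0 R ((U, V) : Box C D) (W, V)) -
      c01 (tm a' (one V') : H0 R ((U', V') : Box C D) (W', V')) y = inL k g := by
  subst hx hy
  rw [inL_tm, tm_inL, ← h, one_c00, c00_one, map_sub, LinearMap.sub_apply]

theorem boxOneR {a : H0 R U W} {a' : H0 R U' W'} {f : H0 R U U'} {f' : H0 R W W'} {l : H1 R V V'}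
    {k : H1 R U W'} {x : H1 R ((W, V) : Box C D) (W', V')} {y : H1 R ((U, V) : Box C D) (U', V')}
    (hx : x = inR f' l) (hy : y = inR f l) (h : c00 f' a - c00 a' f = d k) :
    c10 x (tm a (one V) : H0 R ((U, V) : Box C D) (W, V)) -
      c01 (tm a' (one V') : H0 R ((U', V') : Box C D) (W', V')) y = inL k (d l) := by
  subst hx hy
  rw [inR_tm, tm_inR, inL_d, ← h, one_c01, c10_one, map_sub, LinearMap.sub_apply]

theorem boxOne2 {W'' : C} {f : H0 R U U'} {g : H0 R V V'} {f' : H0 R W' W''} {g' : H0 R V' V''}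
    {k : H1 R U W'} {k' : H1 R U' W''} {k'' : H1 R U W''}
    {x : H0 R ((U, V) : Box C D) (U', V')} {y : H0 R ((W', V') : Box C D) (W'', V'')}
    (hx : x = tm f g) (hy : y = tm f' g') (h : k'' = c10 k' f + c01 f' k) :
    (inL k'' (c00 g' g) : H1 R ((U, V) : Box C D) (W'', V'')) =
      c10 (inL k' g' : H1 R ((U', V') : Box C D) (W'', V'')) x +
        c01 y (inL k g : H1 R ((U, V) : Box C D) (W', V')) := by
  subst hx hy
  rw [inL_tm, tm_inL, h, map_add, LinearMap.add_apply]

variable {Z Z' : D}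

theorem oneBox0 {a : H0 R V Z} {a' : H0 R V' Z'} {f : H0 R U U'} {g : H0 R V V'} {g' : H0 R Z Z'}
    {k : H1 R V Z'} {x : H0 R ((U, Z) : Box C D) (U', Z')} {y : H0 R ((U, V) : Box C D) (U', V')}
    (hx : x = tm f g') (hy : y = tm f g) (h : c00 g' a - c00 a' g = d k) :
    c00 x (tm (one U) a : H0 R ((U, V) : Box C D) (U, Z)) -
      c00 (tm (one U') a' : H0 R ((U', V') : Box C D) (U', Z')) y = d (inR f k) := by
  subst hx hy
  rw [tm_tm, tm_tm, d_inR, ← h, one_c00, c00_one, map_sub]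

theorem oneBoxL {a : H0 R V Z} {a' : H0 R V' Z'} {f : H1 R U U'} {g : H0 R V V'} {g' : H0 R Z Z'}
    {k : H1 R V Z'} {x : H1 R ((U, Z) : Box C D) (U', Z')} {y : H1 R ((U, V) : Box C D) (U', V')}
    (hx : x = inL f g') (hy : y = inL f g) (h : c00 g' a - c00 a' g = d k) :
    c10 x (tm (one U) a : H0 R ((U, V) : Box C D) (U, Z)) -
      c01 (tm (one U') a' : H0 R ((U', V') : Box C D) (U', Z')) y = inR (d f) k := by
  subst hx hy
  rw [inL_tm, tm_inL, ← inL_d, ← h, one_c01, c10_one, map_sub]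

theorem oneBoxR {a : H0 R V Z} {a' : H0 R V' Z'} {f : H0 R U U'} {g : H1 R V V'} {g' : H1 R Z Z'}
    {k : H1 R V Z'} {x : H1 R ((U, Z) : Box C D) (U', Z')} {y : H1 R ((U, V) : Box C D) (U', V')}
    (hx : x = inR f g') (hy : y = inR f g) (h : c10 g' a - c01 a' g = k) :
    c10 x (tm (one U) a : H0 R ((U, V) : Box C D) (U, Z)) -
      c01 (tm (one U') a' : H0 R ((U', V') : Box C D) (U', Z')) y = inR f k := by
  subst hx hy
  rw [inR_tm, tm_inR, ← h, one_c00, c00_one, map_sub]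

theorem oneBox2 {Z'' : D} {f : H0 R U U'} {g : H0 R V V'} {f' : H0 R U' U''} {g' : H0 R Z' Z''}
    {k : H1 R V Z'} {k' : H1 R V' Z''} {k'' : H1 R V Z''}
    {x : H0 R ((U, V) : Box C D) (U', V')} {y : H0 R ((U', Z') : Box C D) (U'', Z'')}
    (hx : x = tm f g) (hy : y = tm f' g') (h : k'' = c10 k' g + c01 g' k) :
    (inR (c00 f' f) k'' : H1 R ((U, V) : Box C D) (U'', Z'')) =
      c10 (inR f' k' : H1 R ((U', V') : Box C D) (U'', Z'')) x +
        c01 y (inR f k : H1 R ((U, V) : Box C D) (U', Z')) := by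
  subst hx hy
  rw [inR_tm, tm_inR, h, map_add]

end Whisker

variable {M : Type*} [AddCommGroup M] [Module R M]

/-- The universal property of the hom complexes of `C ⊠ D` in degree `0`. -/
def lift0 (m : H0 R U U' →ₗ[R] H0 R V V' →ₗ[R] M) : H0 R ((U, V) : Box C D) (U', V') →ₗ[R] M :=
  TensorProduct.lift m

theorem lift0_tm (m : H0 R U U' →ₗ[R] H0 R V V' →ₗ[R] M) (f : H0 R U U') (g : H0 R V V') :
    lift0 m (tm f g) = m f g := rfl

/-- The universal property of the hom complexes of `C ⊠ D` in degree `-1`. -/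
def lift1 (l : H1 R U U' →ₗ[R] H0 R V V' →ₗ[R] M) (r : H0 R U U' →ₗ[R] H1 R V V' →ₗ[R] M)
    (h : ∀ k k', l k (d k') = r (d k) k') : H1 R ((U, V) : Box C D) (U', V') →ₗ[R] M :=
  Submodule.liftQ _ (LinearMap.coprod (TensorProduct.lift l) (TensorProduct.lift r)) (by
    rintro _ ⟨y, rfl⟩
    rw [LinearMap.mem_ker]
    induction y with
    | zero => simp
    | add a b ha hb => rw [map_add, map_add, ha, hb, add_zero]
    | tmul k l => simp [rel, h])

theorem lift1_inL (l : H1 R U U' →ₗ[R] H0 R V V' →ₗ[R] M) (r : H0 R U U' →ₗ[R] H1 R V V' →ₗ[R] M)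
    (h : ∀ k k', l k (d k') = r (d k) k') (k : H1 R U U') (g : H0 R V V') :
    lift1 l r h (inL k g) = l k g := by
  change TensorProduct.lift l (k ⊗ₜ[R] g) + TensorProduct.lift r 0 = _
  simp

theorem lift1_inR (l : H1 R U U' →ₗ[R] H0 R V V' →ₗ[R] M) (r : H0 R U U' →ₗ[R] H1 R V V' →ₗ[R] M)
    (h : ∀ k k', l k (d k') = r (d k) k') (f : H0 R U U') (k : H1 R V V') :
    lift1 l r h (inR f k) = r f k := by
  change TensorProduct.lift l 0 + TensorProduct.lift r (f ⊗ₜ[R] k) = _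
  simp

theorem ext0 {p q : H0 R ((U, V) : Box C D) (U', V') →ₗ[R] M}
    (h : ∀ f g, p (tm f g) = q (tm f g)) : p = q := by
  ext x
  induction x using ind0 with
  | hadd a b ha hb => rw [map_add, map_add, ha, hb]
  | h a b => exact h a b

theorem ext1 {p q : H1 R ((U, V) : Box C D) (U', V') →ₗ[R] M}
    (hl : ∀ k g, p (inL k g) = q (inL k g)) (hr : ∀ f l, p (inR f l) = q (inR f l)) : p = q := by
  ext x
  induction x using ind1 with
  | hadd a b ha hb => rw [map_add, map_add, ha, hb]
  | hl a b => exact hl a b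
  | hr a b => exact hr a b

end
end Box

attribute [irreducible] Box.chCat

namespace ChFunctor
open Box
section

variable {R : Type w} [CommRing R]
  {B : Type u} [ChCat.{w, u, v} R B] {C : Type u'} [ChCat.{w, u', v'} R C]
  {D : Type u''} [ChCat.{w, u'', v''} R D]

/-- A functor on `B ⊠ C` from its values on generators. -/
def ofBi (obj : B → C → D)
    (m00 : ∀ {U U' : B} {V V' : C}, H0 R U U' →ₗ[R] H0 R V V' →ₗ[R] H0 R (obj U V) (obj U' V'))
    (m10 : ∀ {U U' : B} {V V' : C}, H1 R U U' →ₗ[R] H0 R V V' →ₗ[R] H1 R (obj U V) (obj U' V'))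
    (m01 : ∀ {U U' : B} {V V' : C}, H0 R U U' →ₗ[R] H1 R V V' →ₗ[R] H1 R (obj U V) (obj U' V'))
    (hrel : ∀ {U U' : B} {V V' : C} (k : H1 R U U') (l : H1 R V V'), m10 k (d l) = m01 (d k) l)
    (hd10 : ∀ {U U' : B} {V V' : C} (k : H1 R U U') (g : H0 R V V'), d (m10 k g) = m00 (d k) g)
    (hd01 : ∀ {U U' : B} {V V' : C} (f : H0 R U U') (l : H1 R V V'), d (m01 f l) = m00 f (d l))
    (hone : ∀ (U : B) (V : C), m00 (one U) (one V) = one (obj U V))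
    (h00 : ∀ {U U' U'' : B} {V V' V'' : C} (f' : H0 R U' U'') (g' : H0 R V' V'') (f : H0 R U U')
      (g : H0 R V V'), m00 (c00 f' f) (c00 g' g) = c00 (m00 f' g') (m00 f g))
    (h0L : ∀ {U U' U'' : B} {V V' V'' : C} (f' : H0 R U' U'') (g' : H0 R V' V'') (f : H1 R U U')
      (g : H0 R V V'), m10 (c01 f' f) (c00 g' g) = c01 (m00 f' g') (m10 f g))
    (h0R : ∀ {U U' U'' : B} {V V' V'' : C} (f' : H0 R U' U'') (g' : H0 R V' V'') (f : H0 R U U')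
      (g : H1 R V V'), m01 (c00 f' f) (c01 g' g) = c01 (m00 f' g') (m01 f g))
    (hL0 : ∀ {U U' U'' : B} {V V' V'' : C} (f' : H1 R U' U'') (g' : H0 R V' V'') (f : H0 R U U')
      (g : H0 R V V'), m10 (c10 f' f) (c00 g' g) = c10 (m10 f' g') (m00 f g))
    (hR0 : ∀ {U U' U'' : B} {V V' V'' : C} (f' : H0 R U' U'') (g' : H1 R V' V'') (f : H0 R U U')
      (g : H0 R V V'), m01 (c00 f' f) (c10 g' g) = c10 (m01 f' g') (m00 f g)) :
    ChFunctor R (Box B C) D where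
  obj X := obj X.1 X.2
  map0 := lift0 m00
  map1 := lift1 m10 m01 hrel
  map_d {X Y} q := by
    obtain ⟨U, V⟩ := X
    obtain ⟨U', V'⟩ := Y
    induction q using ind1 with
    | hadd a b ha hb => simp only [map_add, ha, hb]
    | hl k g => rw [d_inL, lift0_tm, lift1_inL, hd10]
    | hr k g => rw [d_inR, lift0_tm, lift1_inR, hd01]
  map_one X := by
    obtain ⟨U, V⟩ := X
    rw [one_def, lift0_tm, hone]
  map_c00 {X Y Z} x y := by
    obtain ⟨U, V⟩ := X
    obtain ⟨U', V'⟩ := Y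
    obtain ⟨U'', V''⟩ := Z
    induction x using ind0 with
    | hadd a b ha hb => simp only [map_add, LinearMap.add_apply, ha, hb]
    | h a b =>
      induction y using ind0 with
      | hadd a b ha hb => simp only [map_add, ha, hb]
      | h a b => rw [tm_tm, lift0_tm, lift0_tm, lift0_tm, h00]
  map_c01 {X Y Z} x q := by
    obtain ⟨U, V⟩ := X
    obtain ⟨U', V'⟩ := Y
    obtain ⟨U'', V''⟩ := Z
    induction x using ind0 with
    | hadd a b ha hb => simp only [map_add, LinearMap.add_apply, ha, hb]
    | h a b =>
      induction q using ind1 with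
      | hadd a b ha hb => simp only [map_add, ha, hb]
      | hl k g => rw [tm_inL, lift1_inL, lift0_tm, lift1_inL, h0L]
      | hr k g => rw [tm_inR, lift1_inR, lift0_tm, lift1_inR, h0R]
  map_c10 {X Y Z} q x := by
    obtain ⟨U, V⟩ := X
    obtain ⟨U', V'⟩ := Y
    obtain ⟨U'', V''⟩ := Z
    induction x using ind0 with
    | hadd a b ha hb => simp only [map_add, ha, hb]
    | h a b =>
      induction q using ind1 with
      | hadd a b ha hb => simp only [map_add, LinearMap.add_apply, ha, hb]
      | hl k g => rw [inL_tm, lift1_inL, lift0_tm, lift1_inL, hL0]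
      | hr k g => rw [inR_tm, lift1_inR, lift0_tm, lift1_inR, hR0]

variable {B' : Type*} [ChCat.{w} R B'] {C' : Type*} [ChCat.{w} R C']

/-- The product `F ⊠ G` of two functors. -/
def box (F : ChFunctor R B C) (G : ChFunctor R B' C') : ChFunctor R (Box B B') (Box C C') :=
  ofBi (fun U V => (F.obj U, G.obj V))
    (fun {_ _ _ _} => tm.compl₁₂ F.map0 G.map0)
    (fun {_ _ _ _} => inL.compl₁₂ F.map1 G.map0)
    (fun {_ _ _ _} => inR.compl₁₂ F.map0 G.map1)
    (fun k l => by simp [F.map_d, G.map_d, inL_d])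
    (fun k l => by simp [F.map_d, d_inL])
    (fun k l => by simp [G.map_d, d_inR])
    (fun U V => by simp [F.map_one, G.map_one, one_def])
    (fun f' g' f g => by simp [F.map_c00, G.map_c00, tm_tm])
    (fun f' g' f g => by simp [F.map_c01, G.map_c00, tm_inL])
    (fun f' g' f g => by simp [F.map_c00, G.map_c01, tm_inR])
    (fun f' g' f g => by simp [F.map_c10, G.map_c00, inL_tm])
    (fun f' g' f g => by simp [F.map_c00, G.map_c10, inR_tm])

theorem box_map0_tm (F : ChFunctor R B C) (G : ChFunctor R B' C') {U U' : B} {V V' : B'}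
    (f : H0 R U U') (g : H0 R V V') :
    (F.box G).map0 (tm f g : H0 R ((U, V) : Box B B') (U', V')) = tm (F.map0 f) (G.map0 g) :=
  lift0_tm _ f g

theorem box_map1_inL (F : ChFunctor R B C) (G : ChFunctor R B' C') {U U' : B} {V V' : B'}
    (k : H1 R U U') (g : H0 R V V') :
    (F.box G).map1 (inL k g : H1 R ((U, V) : Box B B') (U', V')) = inL (F.map1 k) (G.map0 g) :=
  lift1_inL _ _ (fun k l => by
    change inL (F.map1 k) (G.map0 (d l)) = inR (F.map0 (d k)) (G.map1 l)
    rw [G.map_d, F.map_d, inL_d]) k g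

theorem box_map1_inR (F : ChFunctor R B C) (G : ChFunctor R B' C') {U U' : B} {V V' : B'}
    (f : H0 R U U') (l : H1 R V V') :
    (F.box G).map1 (inR f l : H1 R ((U, V) : Box B B') (U', V')) = inR (F.map0 f) (G.map1 l) :=
  lift1_inR _ _ (fun k l => by
    change inL (F.map1 k) (G.map0 (d l)) = inR (F.map0 (d k)) (G.map1 l)
    rw [G.map_d, F.map_d, inL_d]) f l

variable (R B C) in
/-- The symmetry `τ : B ⊠ C → C ⊠ B`. -/
def swap : ChFunctor R (Box B C) (Box C B) :=
  ofBi (fun U V => (V, U))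
    (fun {_ _ _ _} => tm.flip) (fun {_ _ _ _} => inR.flip) (fun {_ _ _ _} => inL.flip)
    (fun k l => by simp [inL_d])
    (fun k l => by simp [d_inR])
    (fun k l => by simp [d_inL])
    (fun U V => one_def.symm)
    (fun f' g' f g => by simp [tm_tm])
    (fun f' g' f g => by simp [tm_inR])
    (fun f' g' f g => by simp [tm_inL])
    (fun f' g' f g => by simp [inR_tm])
    (fun f' g' f g => by simp [inL_tm])

variable (C) in
/-- The functor `V ↦ (I, V)`. -/
def insL (I : B) : ChFunctor R C (Box B C) where
  obj V := (I, V)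
  map0 := tm (one I)
  map1 := inR (one I)
  map_d k := by rw [d_inR]
  map_one V := one_def.symm
  map_c00 g f := by rw [tm_tm, one_c00]
  map_c01 g f := by rw [tm_inR, one_c00]
  map_c10 g f := by rw [inR_tm, one_c00]

variable (B) in
/-- The functor `U ↦ (U, I)`. -/
def insR (I : C) : ChFunctor R B (Box B C) where
  obj U := (U, I)
  map0 := tm.flip (one I)
  map1 := inL.flip (one I)
  map_d k := by simp [d_inL]
  map_one V := one_def.symm
  map_c00 g f := by simp [tm_tm, one_c00]
  map_c01 g f := by simp [tm_inL, one_c00]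
  map_c10 g f := by simp [inL_tm, one_c00]

set_option maxHeartbeats 1000000 in
variable (R B C D) in
/-- The associativity isomorphism `(B ⊠ C) ⊠ D → B ⊠ (C ⊠ D)`. -/
def assoc : ChFunctor R (Box (Box B C) D) (Box B (Box C D)) :=
  ofBi (fun X W => (X.1, (X.2, W)))
    (fun {_ _ _ _} => lift0 (LinearMap.mk₂ R (fun f g => (tm f).comp (tm g))
      (fun _ _ _ => by ext; simp) (fun _ _ _ => by ext; simp)
      (fun _ _ _ => by ext; simp) (fun _ _ _ => by ext; simp)))
    (fun {_ _ _ _} => lift1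
      (LinearMap.mk₂ R (fun k g => (inL k).comp (tm g))
        (fun _ _ _ => by ext; simp) (fun _ _ _ => by ext; simp)
        (fun _ _ _ => by ext; simp) (fun _ _ _ => by ext; simp))
      (LinearMap.mk₂ R (fun f l => (inR f).comp (inL l))
        (fun _ _ _ => by ext; simp) (fun _ _ _ => by ext; simp)
        (fun _ _ _ => by ext; simp) (fun _ _ _ => by ext; simp))
      (fun k k' => by ext e; simp [← inL_d, d_inL]))
    (fun {_ _ _ _} => lift0 (LinearMap.mk₂ R (fun f g => (inR f).comp (inR g))
      (fun _ _ _ => by ext; simp) (fun _ _ _ => by ext; simp)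
      (fun _ _ _ => by ext; simp) (fun _ _ _ => by ext; simp)))
    (fun {X Y _ _} q l => by
      obtain ⟨U, V⟩ := X
      obtain ⟨U', V'⟩ := Y
      induction q using ind1 with
      | hadd a b ha hb => simp only [map_add, LinearMap.add_apply, ha, hb]
      | hl k g => simp [lift1_inL, lift0_tm, d_inL, ← inL_d, d_inR]
      | hr f k => simp [lift1_inR, lift0_tm, d_inR, inL_d])
    (fun {X Y _ _} q l => by
      obtain ⟨U, V⟩ := X
      obtain ⟨U', V'⟩ := Y
      induction q using ind1 with
      | hadd a b ha hb => simp only [map_add, LinearMap.add_apply, ha, hb]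
      | hl k g => simp [lift1_inL, lift0_tm, d_inL]
      | hr f k => simp [lift1_inR, lift0_tm, d_inR, d_inL])
    (fun {X Y _ _} x l => by
      obtain ⟨U, V⟩ := X
      obtain ⟨U', V'⟩ := Y
      induction x using ind0 with
      | hadd a b ha hb => simp only [map_add, LinearMap.add_apply, ha, hb]
      | h f g => simp [lift0_tm, d_inR])
    (fun X W => by
      obtain ⟨U, V⟩ := X
      rw [one_def, one_def, one_def]
      rfl)
    (fun {X Y Z _ _ _} x' h' x h => by
      obtain ⟨U, V⟩ := X
      obtain ⟨U', V'⟩ := Y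
      obtain ⟨U'', V''⟩ := Z
      induction x' using ind0 with
      | hadd a b ha hb => simp only [map_add, LinearMap.add_apply, ha, hb]
      | h f' g' =>
        induction x using ind0 with
        | hadd a b ha hb => simp only [map_add, LinearMap.add_apply, ha, hb]
        | h f g => simp [lift0_tm, tm_tm])
    (fun {X Y Z _ _ _} x' h' x h => by
      obtain ⟨U, V⟩ := X
      obtain ⟨U', V'⟩ := Y
      obtain ⟨U'', V''⟩ := Z
      induction x' using ind0 with
      | hadd a b ha hb => simp only [map_add, LinearMap.add_apply, ha, hb]
      | h f' g' =>
        induction x using ind1 with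
        | hadd a b ha hb => simp only [map_add, LinearMap.add_apply, ha, hb]
        | hl f g => simp [lift0_tm, lift1_inL, tm_tm, tm_inL]
        | hr f g => simp [lift0_tm, lift1_inR, tm_inL, tm_inR])
    (fun {X Y Z _ _ _} x' h' x h => by
      obtain ⟨U, V⟩ := X
      obtain ⟨U', V'⟩ := Y
      obtain ⟨U'', V''⟩ := Z
      induction x' using ind0 with
      | hadd a b ha hb => simp only [map_add, LinearMap.add_apply, ha, hb]
      | h f' g' =>
        induction x using ind0 with
        | hadd a b ha hb => simp only [map_add, LinearMap.add_apply, ha, hb]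
        | h f g => simp [lift0_tm, tm_tm, tm_inR])
    (fun {X Y Z _ _ _} x' h' x h => by
      obtain ⟨U, V⟩ := X
      obtain ⟨U', V'⟩ := Y
      obtain ⟨U'', V''⟩ := Z
      induction x using ind0 with
      | hadd a b ha hb => simp only [map_add, LinearMap.add_apply, ha, hb]
      | h f g =>
        induction x' using ind1 with
        | hadd a b ha hb => simp only [map_add, LinearMap.add_apply, ha, hb]
        | hl f g => simp [lift0_tm, lift1_inL, tm_tm, inL_tm]
        | hr f g => simp [lift0_tm, lift1_inR, inL_tm, inR_tm])
    (fun {X Y Z _ _ _} x' h' x h => by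
      obtain ⟨U, V⟩ := X
      obtain ⟨U', V'⟩ := Y
      obtain ⟨U'', V''⟩ := Z
      induction x' using ind0 with
      | hadd a b ha hb => simp only [map_add, LinearMap.add_apply, ha, hb]
      | h f' g' =>
        induction x using ind0 with
        | hadd a b ha hb => simp only [map_add, LinearMap.add_apply, ha, hb]
        | h f g => simp [lift0_tm, tm_tm, inR_tm])

theorem comp_box {B'' : Type*} [ChCat.{w} R B''] {C'' : Type*} [ChCat.{w} R C'']
    (G : ChFunctor R C C'') (F : ChFunctor R B C) (G' : ChFunctor R C' B'')
    (F' : ChFunctor R B' C') : (G.comp F).box (G'.comp F') = (G.box G').comp (F.box F') := by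
  refine ext_of_obj rfl (fun X Y => heq_of_eq ?_) (fun X Y => heq_of_eq ?_)
  · obtain ⟨U, V⟩ := X
    obtain ⟨U', V'⟩ := Y
    exact ext0 (fun f g => rfl)
  · obtain ⟨U, V⟩ := X
    obtain ⟨U', V'⟩ := Y
    refine ext1 (fun f g => ?_) (fun f g => ?_)
    · refine (box_map1_inL _ _ f g).trans ?_
      exact ((congrArg (G.box G').map1 (box_map1_inL F F' f g)).trans
        (box_map1_inL G G' (F.map1 f) (F'.map0 g))).symm
    · refine (box_map1_inR _ _ f g).trans ?_
      exact ((congrArg (G.box G').map1 (box_map1_inR F F' f g)).trans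
        (box_map1_inR G G' (F.map0 f) (F'.map1 g))).symm

end
end ChFunctor

/-! ## Pseudonatural transformations and modifications -/

section PsNat
open Box

variable {R : Type w} [CommRing R] {B : Type*} [ChCat.{w} R B] {C : Type*} [ChCat.{w} R C]
  {D : Type*} [ChCat.{w} R D]

/-- Pseudonatural transformations `ξ : F ⇒ G`.  A pair consists of the components
`ξ_U ∈ D[F U, G U]⁰` and of the homotopies `ξ_f ∈ D[F U, G V]⁻¹` for `f ∈ C[U, V]⁰` (the homotopy
vanishes on elements of degree `-1`). -/
def psNatSubmodule (F G : ChFunctor R B C) :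
    Submodule R ((∀ U, H0 R (F.obj U) (G.obj U)) ×
      (∀ U V, H0 R U V →ₗ[R] H1 R (F.obj U) (G.obj V))) where
  carrier := {ξ |
    (∀ (U V : B) (f : H0 R U V),
      c00 (G.map0 f) (ξ.1 U) - c00 (ξ.1 V) (F.map0 f) = d (ξ.2 U V f)) ∧
    (∀ (U V : B) (k : H1 R U V),
      c10 (G.map1 k) (ξ.1 U) - c01 (ξ.1 V) (F.map1 k) = ξ.2 U V (d k)) ∧
    (∀ (U V W : B) (g : H0 R V W) (f : H0 R U V),
      ξ.2 U W (c00 g f) = c10 (ξ.2 V W g) (F.map0 f) + c01 (G.map0 g) (ξ.2 U V f))}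
  zero_mem' := by simp
  add_mem' := by
    rintro ξ θ ⟨h1, h2, h3⟩ ⟨k1, k2, k3⟩
    refine ⟨fun U V f => ?_, fun U V f => ?_, fun U V W g f => ?_⟩
    · simp only [Prod.fst_add, Prod.snd_add, Pi.add_apply, map_add, LinearMap.add_apply, ← h1, ← k1]
      abel
    · simp only [Prod.fst_add, Prod.snd_add, Pi.add_apply, map_add, LinearMap.add_apply, ← h2, ← k2]
      abel
    · simp only [Prod.snd_add, Pi.add_apply, map_add, LinearMap.add_apply, h3, k3]
      abel
  smul_mem' := by
    rintro r ξ ⟨h1, h2, h3⟩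
    refine ⟨fun U V f => ?_, fun U V f => ?_, fun U V W g f => ?_⟩
    · simp only [Prod.smul_fst, Prod.smul_snd, Pi.smul_apply, map_smul, LinearMap.smul_apply, ← h1,
        smul_sub]
    · simp only [Prod.smul_fst, Prod.smul_snd, Pi.smul_apply, map_smul, LinearMap.smul_apply, ← h2,
        smul_sub]
    · simp only [Prod.smul_snd, Pi.smul_apply, map_smul, LinearMap.smul_apply, h3, smul_add]

/-- The `R`-module of pseudonatural transformations `F ⇒ G`. -/
def PsNat (F G : ChFunctor R B C) := ↥(psNatSubmodule F G)

namespace PsNat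

variable {F G H K : ChFunctor R B C}

instance : AddCommGroup (PsNat F G) := (psNatSubmodule F G).addCommGroup
instance : Module R (PsNat F G) := (psNatSubmodule F G).module

def app (ξ : PsNat F G) (U : B) : H0 R (F.obj U) (G.obj U) := ξ.1.1 U

def hot (ξ : PsNat F G) {U V : B} : H0 R U V →ₗ[R] H1 R (F.obj U) (G.obj V) := ξ.1.2 U V

theorem nat0 (ξ : PsNat F G) {U V : B} (f : H0 R U V) :
    c00 (G.map0 f) (ξ.app U) - c00 (ξ.app V) (F.map0 f) = d (ξ.hot f) := ξ.2.1 U V f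

theorem nat1 (ξ : PsNat F G) {U V : B} (k : H1 R U V) :
    c10 (G.map1 k) (ξ.app U) - c01 (ξ.app V) (F.map1 k) = ξ.hot (d k) := ξ.2.2.1 U V k

theorem hot_c00 (ξ : PsNat F G) {U V W : B} (g : H0 R V W) (f : H0 R U V) :
    ξ.hot (c00 g f) = c10 (ξ.hot g) (F.map0 f) + c01 (G.map0 g) (ξ.hot f) := ξ.2.2.2 U V W g f

def mk (app : ∀ U, H0 R (F.obj U) (G.obj U))
    (hot : ∀ U V, H0 R U V →ₗ[R] H1 R (F.obj U) (G.obj V))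
    (h0 : ∀ (U V : B) (f : H0 R U V),
      c00 (G.map0 f) (app U) - c00 (app V) (F.map0 f) = d (hot U V f))
    (h1 : ∀ (U V : B) (k : H1 R U V),
      c10 (G.map1 k) (app U) - c01 (app V) (F.map1 k) = hot U V (d k))
    (h2 : ∀ (U V W : B) (g : H0 R V W) (f : H0 R U V),
      hot U W (c00 g f) = c10 (hot V W g) (F.map0 f) + c01 (G.map0 g) (hot U V f)) : PsNat F G :=
  ⟨(app, hot), h0, h1, h2⟩

variable (F) in
def one : PsNat F F :=
  mk (fun U => ChCat.one (F.obj U)) 0 (fun U V f => by simp [one_c00, c00_one])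
    (fun U V f => by simp [one_c01, c10_one]) (fun U V W g f => by simp)

/-- Vertical composition. -/
def comp (θ : PsNat G H) (ξ : PsNat F G) : PsNat F H :=
  mk (fun U => c00 (θ.app U) (ξ.app U))
    (fun U V => (c10.flip (ξ.app U)) ∘ₗ θ.hot + (c01 (θ.app V)) ∘ₗ ξ.hot)
    (fun U V f => by
      simp only [LinearMap.add_apply, LinearMap.comp_apply, LinearMap.flip_apply, map_add, d_c10,
        d_c01, ← nat0, map_sub, LinearMap.sub_apply, assoc000]
      abel)
    (fun U V f => by
      simp only [LinearMap.add_apply, LinearMap.comp_apply, LinearMap.flip_apply,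
        ← nat1, map_sub, assoc100, assoc010, assoc001]
      abel)
    (fun U V W g f => by
      have e1 : c10 (θ.hot g) (c00 (G.map0 f) (ξ.app U)) - c10 (θ.hot g) (c00 (ξ.app V) (F.map0 f))
          = c01 (c00 (H.map0 g) (θ.app V)) (ξ.hot f) - c01 (c00 (θ.app W) (G.map0 g)) (ξ.hot f) := by
        rw [← map_sub, nat0, ← trunc, ← nat0, map_sub, LinearMap.sub_apply]
      simp only [assoc001] at e1
      simp only [LinearMap.add_apply, LinearMap.comp_apply, LinearMap.flip_apply, map_add, hot_c00,
        assoc100, assoc010]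
      rw [sub_eq_sub_iff_add_eq_add] at e1
      have e2 : c10 (θ.hot g) (c00 (G.map0 f) (ξ.app U)) =
        c01 (H.map0 g) (c01 (θ.app V) (ξ.hot f)) + c10 (θ.hot g) (c00 (ξ.app V) (F.map0 f))
          - c01 (θ.app W) (c01 (G.map0 g) (ξ.hot f)) := eq_sub_of_add_eq e1
      rw [e2]
      abel)

/-- The whiskering `H(ξ)`. -/
def post {F G : ChFunctor R B C} (H : ChFunctor R C D) (ξ : PsNat F G) :
    PsNat (H.comp F) (H.comp G) :=
  mk (fun U => H.map0 (ξ.app U)) (fun U V => H.map1 ∘ₗ ξ.hot)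
    (fun U V f => by
      change c00 (H.map0 (G.map0 f)) (H.map0 (ξ.app U)) -
        c00 (H.map0 (ξ.app V)) (H.map0 (F.map0 f)) = d (H.map1 (ξ.hot f))
      rw [← H.map_c00, ← H.map_c00, ← H.map_d, ← nat0, map_sub])
    (fun U V f => by
      change c10 (H.map1 (G.map1 f)) (H.map0 (ξ.app U)) -
        c01 (H.map0 (ξ.app V)) (H.map1 (F.map1 f)) = H.map1 (ξ.hot (d f))
      rw [← H.map_c10, ← H.map_c01, ← nat1, map_sub])
    (fun U V W g f => by
      change H.map1 (ξ.hot (c00 g f)) = c10 (H.map1 (ξ.hot g)) (H.map0 (F.map0 f)) +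
        c01 (H.map0 (G.map0 g)) (H.map1 (ξ.hot f))
      rw [hot_c00, map_add, H.map_c10, H.map_c01])

/-- The whiskering `ξ_H`. -/
def pre {F G : ChFunctor R C D} (ξ : PsNat F G) (H : ChFunctor R B C) :
    PsNat (F.comp H) (G.comp H) :=
  mk (fun U => ξ.app (H.obj U)) (fun U V => ξ.hot ∘ₗ H.map0)
    (fun U V f => ξ.nat0 (H.map0 f))
    (fun U V f => (ξ.nat1 (H.map1 f)).trans (congrArg ξ.hot (H.map_d f).symm))
    (fun U V W g f => (congrArg ξ.hot (H.map_c00 g f)).trans (ξ.hot_c00 (H.map0 g) (H.map0 f)))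

/-- A pseudonatural transformation between functors on `B ⊠ C` from its values on generators. -/
def ofBi {F G : ChFunctor R (Box B C) D} (app : ∀ X, H0 R (F.obj X) (G.obj X))
    (hot : ∀ (U U' : B) (V V' : C),
      H0 R U U' →ₗ[R] H0 R V V' →ₗ[R] H1 R (F.obj (U, V)) (G.obj (U', V')))
    (h0 : ∀ (U U' : B) (V V' : C) (f : H0 R U U') (g : H0 R V V'),
      c00 (G.map0 (tm f g)) (app (U, V)) - c00 (app (U', V')) (F.map0 (tm f g)) =
        d (hot U U' V V' f g))
    (hL : ∀ (U U' : B) (V V' : C) (k : H1 R U U') (g : H0 R V V'),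
      c10 (G.map1 (inL k g)) (app (U, V)) - c01 (app (U', V')) (F.map1 (inL k g)) =
        hot U U' V V' (d k) g)
    (hR : ∀ (U U' : B) (V V' : C) (f : H0 R U U') (l : H1 R V V'),
      c10 (G.map1 (inR f l)) (app (U, V)) - c01 (app (U', V')) (F.map1 (inR f l)) =
        hot U U' V V' f (d l))
    (h2 : ∀ (U U' U'' : B) (V V' V'' : C) (f' : H0 R U' U'') (g' : H0 R V' V'') (f : H0 R U U')
      (g : H0 R V V'), hot U U'' V V'' (c00 f' f) (c00 g' g) =
        c10 (hot U' U'' V' V'' f' g') (F.map0 (tm f g)) +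
          c01 (G.map0 (tm f' g')) (hot U U' V V' f g)) : PsNat F G :=
  mk app (fun X Y => lift0 (hot X.1 Y.1 X.2 Y.2))
    (fun X Y x => by
      obtain ⟨U, V⟩ := X
      obtain ⟨U', V'⟩ := Y
      induction x using ind0 with
      | hadd a b ha hb =>
        rw [map_add, map_add, map_add, map_add, map_add, map_add, LinearMap.add_apply, ← ha, ← hb]
        abel
      | h f g => rw [lift0_tm, h0])
    (fun X Y x => by
      obtain ⟨U, V⟩ := X
      obtain ⟨U', V'⟩ := Y
      induction x using ind1 with
      | hadd a b ha hb =>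
        rw [map_add, map_add, map_add, map_add, map_add, map_add, LinearMap.add_apply, ← ha, ← hb]
        abel
      | hl k g => rw [hL, d_inL, lift0_tm]
      | hr f l => rw [hR, d_inR, lift0_tm])
    (fun X Y Z x y => by
      obtain ⟨U, V⟩ := X
      obtain ⟨U', V'⟩ := Y
      obtain ⟨U'', V''⟩ := Z
      induction x using ind0 with
      | hadd a b ha hb =>
        simp only [map_add, LinearMap.add_apply, ha, hb]
        abel
      | h f' g' =>
        induction y using ind0 with
        | hadd a b ha hb =>
          simp only [map_add, ha, hb]
          abel
        | h f g => rw [tm_tm, lift0_tm, lift0_tm, lift0_tm, h2])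

def boxOneApp (D : Type*) [ChCat.{w} R D] (ξ : PsNat F G) (X : Box B D) :
    H0 R ((F.box (ChFunctor.id R D)).obj X) ((G.box (ChFunctor.id R D)).obj X) :=
  tm (ξ.app X.1) (ChCat.one X.2)

def boxOneHot (D : Type*) [ChCat.{w} R D] (ξ : PsNat F G) (U U' : B) (V V' : D) :
    H0 R U U' →ₗ[R] H0 R V V' →ₗ[R]
      H1 R ((F.box (ChFunctor.id R D)).obj (U, V)) ((G.box (ChFunctor.id R D)).obj (U', V')) :=
  inL ∘ₗ ξ.hot

/-- `ξ ⊠ 1 : F ⊠ id ⇒ G ⊠ id`. -/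
def boxOne (D : Type*) [ChCat.{w} R D] (ξ : PsNat F G) :
    PsNat (F.box (ChFunctor.id R D)) (G.box (ChFunctor.id R D)) := by
  refine ofBi (boxOneApp D ξ) (boxOneHot D ξ) ?_ ?_ ?_ ?_
  · exact fun _ _ _ _ f g => boxOne0 (ChFunctor.box_map0_tm G _ f g)
      (ChFunctor.box_map0_tm F _ f g) (ξ.nat0 f)
  · exact fun _ _ _ _ k g => boxOneL (ChFunctor.box_map1_inL G _ k g)
      (ChFunctor.box_map1_inL F _ k g) (ξ.nat1 k)
  · exact fun _ _ _ _ f l => boxOneR (ChFunctor.box_map1_inR G _ f l)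
      (ChFunctor.box_map1_inR F _ f l) (ξ.nat0 f)
  · exact fun _ _ _ _ _ _ f' g' f g => boxOne2 (ChFunctor.box_map0_tm F _ f g)
      (ChFunctor.box_map0_tm G _ f' g') (ξ.hot_c00 f' f)

def oneBoxApp (D : Type*) [ChCat.{w} R D] (ξ : PsNat F G) (X : Box D B) :
    H0 R (((ChFunctor.id R D).box F).obj X) (((ChFunctor.id R D).box G).obj X) :=
  tm (ChCat.one X.1) (ξ.app X.2)

def oneBoxHot (D : Type*) [ChCat.{w} R D] (ξ : PsNat F G) (V V' : D) (U U' : B) :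
    H0 R V V' →ₗ[R] H0 R U U' →ₗ[R]
      H1 R (((ChFunctor.id R D).box F).obj (V, U)) (((ChFunctor.id R D).box G).obj (V', U')) :=
  inR.compl₂ ξ.hot

/-- `1 ⊠ ξ : id ⊠ F ⇒ id ⊠ G`. -/
def oneBox (D : Type*) [ChCat.{w} R D] (ξ : PsNat F G) :
    PsNat ((ChFunctor.id R D).box F) ((ChFunctor.id R D).box G) := by
  refine ofBi (oneBoxApp D ξ) (oneBoxHot D ξ) ?_ ?_ ?_ ?_
  · exact fun _ _ _ _ f g => oneBox0 (ChFunctor.box_map0_tm _ G f g)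
      (ChFunctor.box_map0_tm _ F f g) (ξ.nat0 g)
  · exact fun _ _ _ _ k g => oneBoxL (ChFunctor.box_map1_inL _ G k g)
      (ChFunctor.box_map1_inL _ F k g) (ξ.nat0 g)
  · exact fun _ _ _ _ f l => oneBoxR (ChFunctor.box_map1_inR _ G f l)
      (ChFunctor.box_map1_inR _ F f l) (ξ.nat1 l)
  · exact fun _ _ _ _ _ _ f' g' f g => oneBox2 (ChFunctor.box_map0_tm _ F f g)
      (ChFunctor.box_map0_tm _ G f' g') (ξ.hot_c00 g' g)

/-- Transport of a pseudonatural endomorphism along an equality of functors. -/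
def cast (h : F = G) (ξ : PsNat F F) : PsNat G G := h ▸ ξ

end PsNat

/-- `Ξ` is a modification from `ξ` to `ξ'`. -/
def IsModification {F G : ChFunctor R B C} (ξ ξ' : PsNat F G)
    (Ξ : ∀ U, H1 R (F.obj U) (G.obj U)) : Prop :=
  (∀ U, d (Ξ U) = ξ.app U - ξ'.app U) ∧
  ∀ (U V : B) (f : H0 R U V),
    c10 (Ξ V) (F.map0 f) + ξ.hot f = ξ'.hot f + c01 (G.map0 f) (Ξ U)

/-- The `R`-module of endomodifications `Ξ : ξ ⇛ 0` of `F`, where `ξ` is an arbitrary pseudonatural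
endomorphism of `F`. -/
def modTo0Submodule (F : ChFunctor R B C) :
    Submodule R (PsNat F F × (∀ U, H1 R (F.obj U) (F.obj U))) where
  carrier := {p | IsModification p.1 0 p.2}
  zero_mem' := by
    refine ⟨fun U => ?_, fun U V f => ?_⟩ <;> simp
  add_mem' := by
    rintro ⟨ξ, Ξ⟩ ⟨θ, Θ⟩ ⟨h1, h2⟩ ⟨k1, k2⟩
    have z : ∀ U V (f : H0 R U V), (0 : PsNat F F).hot f = 0 := fun _ _ _ => rfl
    have z' : ∀ U, (0 : PsNat F F).app U = 0 := fun _ => rfl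
    have a : ∀ U, (ξ + θ).app U = ξ.app U + θ.app U := fun _ => rfl
    have a' : ∀ U V (f : H0 R U V), (ξ + θ).hot f = ξ.hot f + θ.hot f := fun _ _ _ => rfl
    simp only [z, z', sub_zero, zero_add] at h1 h2 k1 k2
    refine ⟨fun U => ?_, fun U V f => ?_⟩
    · simp [z', a, h1, k1]
    · simp only [Prod.mk_add_mk, Pi.add_apply, map_add, LinearMap.add_apply, z, zero_add, a', ← h2,
        ← k2]
      abel
  smul_mem' := by
    rintro r ⟨ξ, Ξ⟩ ⟨h1, h2⟩
    have z : ∀ U V (f : H0 R U V), (0 : PsNat F F).hot f = 0 := fun _ _ _ => rfl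
    have z' : ∀ U, (0 : PsNat F F).app U = 0 := fun _ => rfl
    have a : ∀ U, (r • ξ).app U = r • ξ.app U := fun _ => rfl
    have a' : ∀ U V (f : H0 R U V), (r • ξ).hot f = r • ξ.hot f := fun _ _ _ => rfl
    simp only [z, z', sub_zero, zero_add] at h1 h2
    refine ⟨fun U => ?_, fun U V f => ?_⟩
    · simp [z', a, h1]
    · simp only [Prod.smul_mk, Pi.smul_apply, map_smul, LinearMap.smul_apply, z, zero_add, a', ← h2,
        smul_add]

/-- The module of endomodifications-to-`0` of `F`. -/
def ModTo0 (F : ChFunctor R B C) := ↥(modTo0Submodule F)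

namespace ModTo0

variable {F G : ChFunctor R B C}

instance : AddCommGroup (ModTo0 F) := (modTo0Submodule F).addCommGroup
instance : Module R (ModTo0 F) := (modTo0Submodule F).module
instance [Algebra ℂ R] : Module ℂ (ModTo0 F) := Module.compHom _ (algebraMap ℂ R)

/-- The domain `∂Ξ` of `Ξ : ∂Ξ ⇛ 0`. -/
def src (Ξ : ModTo0 F) : PsNat F F := Ξ.1.1

def app (Ξ : ModTo0 F) (U : B) : H1 R (F.obj U) (F.obj U) := Ξ.1.2 U

theorem d_app (Ξ : ModTo0 F) (U : B) : d (Ξ.app U) = Ξ.src.app U :=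
  (Ξ.2.1 U).trans (sub_zero _)

theorem app_nat (Ξ : ModTo0 F) {U V : B} (f : H0 R U V) :
    c10 (Ξ.app V) (F.map0 f) + Ξ.src.hot f = c01 (F.map0 f) (Ξ.app U) :=
  (Ξ.2.2 U V f).trans (zero_add _)

def mk (ξ : PsNat F F) (Ξ : ∀ U, H1 R (F.obj U) (F.obj U)) (h : ∀ U, d (Ξ U) = ξ.app U)
    (h' : ∀ (U V : B) (f : H0 R U V),
      c10 (Ξ V) (F.map0 f) + ξ.hot f = c01 (F.map0 f) (Ξ U)) : ModTo0 F :=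
  ⟨(ξ, Ξ), fun U => (h U).trans (sub_zero _).symm, fun U V f => (h' U V f).trans (zero_add _).symm⟩

/-- The whiskering `θ Ξ`. -/
def whiskL (θ : PsNat F F) (Ξ : ModTo0 F) : ModTo0 F :=
  mk (θ.comp Ξ.src) (fun U => c01 (θ.app U) (Ξ.app U))
    (fun U => by rw [d_c01, d_app]; rfl)
    (fun U V f => by
      change c10 (c01 (θ.app V) (Ξ.app V)) (F.map0 f) +
        (c10 (θ.hot f) (Ξ.src.app U) + c01 (θ.app V) (Ξ.src.hot f)) =
          c01 (F.map0 f) (c01 (θ.app U) (Ξ.app U))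
      rw [← d_app, ← trunc, ← PsNat.nat0, eq_sub_of_add_eq' (Ξ.app_nat f)]
      simp only [map_sub, LinearMap.sub_apply, assoc010, assoc001]
      abel)

/-- The whiskering `Ξ θ`. -/
def whiskR (Ξ : ModTo0 F) (θ : PsNat F F) : ModTo0 F :=
  mk (Ξ.src.comp θ) (fun U => c10 (Ξ.app U) (θ.app U))
    (fun U => by rw [d_c10, d_app]; rfl)
    (fun U V f => by
      change c10 (c10 (Ξ.app V) (θ.app V)) (F.map0 f) +
        (c10 (Ξ.src.hot f) (θ.app U) + c01 (Ξ.src.app V) (θ.hot f)) =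
          c01 (F.map0 f) (c10 (Ξ.app U) (θ.app U))
      rw [← d_app, trunc, ← PsNat.nat0, eq_sub_of_add_eq' (Ξ.app_nat f)]
      simp only [map_sub, LinearMap.sub_apply, assoc010, assoc100]
      abel)

/-- The whiskering `Ξ_H` by a functor. -/
def pre {F : ChFunctor R C D} (Ξ : ModTo0 F) (H : ChFunctor R B C) : ModTo0 (F.comp H) :=
  mk (Ξ.src.pre H) (fun U => Ξ.app (H.obj U)) (fun U => Ξ.d_app _)
    (fun U V f => Ξ.app_nat (H.map0 f))

/-- Transport of an endomodification along an equality of functors. -/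
def cast (h : F = G) (Ξ : ModTo0 F) : ModTo0 G := h ▸ Ξ

/-- For `s : S ⇒ S : B → C` and `t : T ⇒ T : C → D`, the modification
`t_s : T(s) t_S - t_S T(s) ⇛ 0` with components `t_{s_U}`. -/
def exchange {T : ChFunctor R C D} {S : ChFunctor R B C} (t : PsNat T T) (s : PsNat S S) :
    ModTo0 (T.comp S) :=
  mk ((s.post T).comp (t.pre S) - (t.pre S).comp (s.post T)) (fun U => t.hot (s.app U))
    (fun U => (t.nat0 (s.app U)).symm)
    (fun U V f => by
      change c10 (t.hot (s.app V)) (T.map0 (S.map0 f)) +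
        ((c10 (T.map1 (s.hot f)) (t.app (S.obj U)) + c01 (T.map0 (s.app V)) (t.hot (S.map0 f))) -
          (c10 (t.hot (S.map0 f)) (T.map0 (s.app U)) + c01 (t.app (S.obj V)) (T.map1 (s.hot f)))) =
        c01 (T.map0 (S.map0 f)) (t.hot (s.app U))
      have e1 := t.nat1 (s.hot f)
      rw [← PsNat.nat0, map_sub, t.hot_c00, t.hot_c00] at e1
      rw [sub_eq_iff_eq_add] at e1
      rw [e1]
      abel)

end ModTo0
end PsNat

/-! ## Symmetric strict monoidal cochain 2-categories and infinitesimal 2-braidings -/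

section Monoidal
open Box

variable {R : Type w} [CommRing R]

theorem ChFunctor.swap_map1_inL {B : Type u} [ChCat.{w, u, v} R B] {C : Type u'}
    [ChCat.{w, u', v'} R C] {U U' : B} {V V' : C} (k : H1 R U U') (g : H0 R V V') :
    (ChFunctor.swap R B C).map1 (inL k g : H1 R ((U, V) : Box B C) (U', V')) = inR g k :=
  lift1_inL inR.flip inL.flip (fun k l => (inL_d l k).symm) k g

theorem ChFunctor.swap_map1_inR {B : Type u} [ChCat.{w, u, v} R B] {C : Type u'}
    [ChCat.{w, u', v'} R C] {U U' : B} {V V' : C} (f : H0 R U U') (l : H1 R V V') :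
    (ChFunctor.swap R B C).map1 (inR f l : H1 R ((U, V) : Box B C) (U', V')) = inL l f :=
  lift1_inR inR.flip inL.flip (fun k l => (inL_d l k).symm) f l

/-- A symmetric strict monoidal structure on a cochain 2-category.  The morphisms `eqHom _` in the
hexagon axiom are identities which account for the equality `U ⊗ (V ⊗ W) = (U ⊗ V) ⊗ W`. -/
structure SymStrictMonoidal (R : Type w) [CommRing R] (C : Type u) [ChCat.{w, u, v} R C] where
  tensor : ChFunctor R (Box C C) C
  unit : C
  assoc : (tensor.comp ((ChFunctor.id R C).box tensor)).comp (ChFunctor.assoc R C C C) =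
    tensor.comp (tensor.box (ChFunctor.id R C))
  unit_tensor : tensor.comp (ChFunctor.insL C unit) = ChFunctor.id R C
  tensor_unit : tensor.comp (ChFunctor.insR C unit) = ChFunctor.id R C
  γ : PsNat tensor (tensor.comp (ChFunctor.swap R C C))
  γ_natural : ∀ {X Y : Box C C} (f : H0 R X Y), γ.hot f = 0
  γ_involutive : ∀ U V : C, c00 (γ.app (V, U)) (γ.app (U, V)) = one (tensor.obj (U, V))
  assoc_obj (U V W : C) : tensor.obj (U, tensor.obj (V, W)) = tensor.obj (tensor.obj (U, V), W) :=
    congrArg (fun F => F.obj ((U, V), W)) assoc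
  hexagon : ∀ U V W : C, γ.app (tensor.obj (U, V), W) =
    c00 (eqHom R (assoc_obj W U V).symm) (c00 (tensor.map0 (tm (γ.app (U, W)) (one V)))
      (c00 (eqHom R (assoc_obj U W V)) (c00 (tensor.map0 (tm (one U) (γ.app (V, W))))
        (eqHom R (assoc_obj U V W).symm))))

namespace SymStrictMonoidal

variable {C : Type u} [ChCat.{w, u, v} R C] (S : SymStrictMonoidal R C)

/-- The threefold product `⊗² : (U, V, W) ↦ U ⊗ V ⊗ W`. -/
def tensor2 : ChFunctor R (Box (Box C C) C) C := S.tensor.comp (S.tensor.box (ChFunctor.id R C))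

/-- The component `γ_{U, V} : U ⊗ V → V ⊗ U`. -/
def br (U V : C) : H0 R (S.tensor.obj (U, V)) (S.tensor.obj (V, U)) := S.γ.app (U, V)

theorem br_tm {U U' V V' : C} (f : H0 R U U') (g : H0 R V V') :
    c00 (S.tensor.map0 (tm g f)) (S.br U V) = c00 (S.br U' V') (S.tensor.map0 (tm f g)) := by
  have h := S.γ.nat0 (tm f g : H0 R ((U, V) : Box C C) (U', V'))
  rw [S.γ_natural, map_zero] at h
  exact sub_eq_zero.1 h

theorem br_inL {U U' V V' : C} (k : H1 R U U') (g : H0 R V V') :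
    c10 (S.tensor.map1 (inR g k)) (S.br U V) = c01 (S.br U' V') (S.tensor.map1 (inL k g)) := by
  have h := S.γ.nat1 (inL k g : H1 R ((U, V) : Box C C) (U', V'))
  rw [S.γ_natural] at h
  exact (congrArg (fun x : H1 R (S.tensor.obj (V, U)) (S.tensor.obj (V', U')) =>
    c10 x (S.br U V)) (congrArg S.tensor.map1 (ChFunctor.swap_map1_inL k g))).symm.trans
      (sub_eq_zero.1 h)

theorem br_inR {U U' V V' : C} (f : H0 R U U') (l : H1 R V V') :
    c10 (S.tensor.map1 (inL l f)) (S.br U V) = c01 (S.br U' V') (S.tensor.map1 (inR f l)) := by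
  have h := S.γ.nat1 (inR f l : H1 R ((U, V) : Box C C) (U', V'))
  rw [S.γ_natural] at h
  exact (congrArg (fun x : H1 R (S.tensor.obj (V, U)) (S.tensor.obj (V', U')) =>
    c10 x (S.br U V)) (congrArg S.tensor.map1 (ChFunctor.swap_map1_inR f l))).symm.trans
      (sub_eq_zero.1 h)

/-- The inverse of the symmetric braiding; by involutivity its component at `(U, V)` is
`γ_{V, U}`. -/
def γinv : PsNat (S.tensor.comp (ChFunctor.swap R C C)) S.tensor :=
  PsNat.ofBi (fun X => S.br X.2 X.1) 0
    (fun U U' V V' f g => (sub_eq_zero.2 (S.br_tm g f)).trans (map_zero _).symm)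
    (fun U U' V V' k g => sub_eq_zero.2 ((S.br_inR g k).trans
      (congrArg (fun x : H1 R (S.tensor.obj (V, U)) (S.tensor.obj (V', U')) =>
        c01 (S.br V' U') x) (congrArg S.tensor.map1 (ChFunctor.swap_map1_inL k g)).symm)))
    (fun U U' V V' f l => sub_eq_zero.2 ((S.br_inL l f).trans
      (congrArg (fun x : H1 R (S.tensor.obj (V, U)) (S.tensor.obj (V', U')) =>
        c01 (S.br V' U') x) (congrArg S.tensor.map1 (ChFunctor.swap_map1_inR f l)).symm)))
    (fun U U' U'' V V' V'' f' g' f g => by simp)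

/-- Infinitesimal 2-braidings. -/
abbrev Inf2Braiding := PsNat S.tensor S.tensor

variable {S : SymStrictMonoidal R C} (t : S.Inf2Braiding)

/-- `t` is symmetric: `t = γ⁻¹ t_τ γ`. -/
def IsSymmetric : Prop :=
  t = S.γinv.comp ((PsNat.pre t (ChFunctor.swap R C C)).comp S.γ)

def t12 : PsNat S.tensor2 S.tensor2 := (PsNat.boxOne C t).post S.tensor

def t23 : PsNat S.tensor2 S.tensor2 :=
  PsNat.cast S.assoc (((PsNat.oneBox C t).post S.tensor).pre (ChFunctor.assoc R C C C))

/-- `t_{(12)3}`. -/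
def tL : PsNat S.tensor2 S.tensor2 := PsNat.pre t (S.tensor.box (ChFunctor.id R C))

/-- `t_{1(23)}`. -/
def tR : PsNat S.tensor2 S.tensor2 :=
  PsNat.cast S.assoc
    ((PsNat.pre t ((ChFunctor.id R C).box S.tensor)).pre (ChFunctor.assoc R C C C))

/-- `(U, V, W) ↦ V ⊗ U ⊗ W`, written in two ways. -/
theorem tensor2_swap : S.tensor2.comp ((ChFunctor.swap R C C).box (ChFunctor.id R C)) =
    S.tensor.comp ((S.tensor.comp (ChFunctor.swap R C C)).box (ChFunctor.id R C)) :=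
  (congrArg S.tensor.comp
    (ChFunctor.comp_box S.tensor (ChFunctor.swap R C C) (ChFunctor.id R C) (ChFunctor.id R C))).symm

/-- `t_{13}`, the conjugate of `t_{23}` by the symmetric braiding of the first two factors. -/
def t13 : PsNat S.tensor2 S.tensor2 :=
  ((PsNat.boxOne C S.γinv).post S.tensor).comp
    ((PsNat.cast tensor2_swap ((t23 t).pre ((ChFunctor.swap R C C).box (ChFunctor.id R C)))).comp
      ((PsNat.boxOne C S.γ).post S.tensor))

/-- `t` is strict: `t_{1(23)} = t_{12} + t_{13}` and `t_{(12)3} = t_{23} + t_{13}`. -/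
def IsStrict : Prop := tR t = t12 t + t13 t ∧ tL t = t23 t + t13 t

/-- The left 4-term relationator `𝓛 = t_{t_{12}} : [t_{12}, t_{(12)3}] ⇛ 0`. -/
def relL : ModTo0 S.tensor2 := ModTo0.exchange t (PsNat.boxOne C t)

/-- The right 4-term relationator `𝓡 = t_{t_{23}} : [t_{23}, t_{1(23)}] ⇛ 0`. -/
def relR : ModTo0 S.tensor2 :=
  ModTo0.cast S.assoc
    ((ModTo0.exchange t (PsNat.oneBox C t)).pre (ChFunctor.assoc R C C C))

end SymStrictMonoidal
end Monoidal

/-! ## 2-connections, parallel transport and 2-holonomy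

Scalar forms on a complex vector space `E` are functions of the base point: a 1-form assigns to each
point a linear functional and a 2-form assigns to each point an alternating form in two tangent
vectors. -/

section TwoConnections

/-- The iterated integral `∫_a^b ω₁ ⋯ ωₙ = ∫_a^b f₁(s) (∫_a^s ω₂ ⋯ ωₙ) ds` of the 1-forms
`ωᵢ = fᵢ(s) ds`. -/
noncomputable def iterInt : List (ℝ → ℂ) → ℝ → ℝ → ℂ
  | [], _, _ => 1
  | f :: l, a, b => ∫ s in a..b, f s * iterInt l a s

/-- `(α ∧ β)[X, Y] = (α(X) β(Y) - α(Y) β(X)) / 2`. -/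
noncomputable def wedge {E : Type*} [NormedAddCommGroup E] [NormedSpace ℂ E] (α β : E →L[ℂ] ℂ)
    (X Y : E) : ℂ := (α X * β Y - α Y * β X) / 2

variable {R : Type w} [CommRing R] [Algebra ℂ R] {B : Type*} [ChCat.{w} R B] {C : Type*}
  [ChCat.{w} R C]

/-- A 2-connection on `E`, of the form `(A, Δ) = (∑ᵢ αᵢ Tᵢ, ∑ₖ βₖ Mₖ)`, with scalar 1-forms `αᵢ`,
pseudonatural endomorphisms `Tᵢ : F ⇒ F`, scalar 2-forms `βₖ` and endomodifications-to-`0` `Mₖ`.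
With the deformation parameter `ħ` written out it is `(ħ A, ħ² Δ)`. -/
structure TwoConn (E : Type*) [NormedAddCommGroup E] [NormedSpace ℂ E] (F : ChFunctor R B C)
    (ι κ : Type) where
  α : ι → E → (E →L[ℂ] ℂ)
  T : ι → PsNat F F
  β : κ → E → E → E → ℂ
  M : κ → ModTo0 F

/-- The composite `T_{w₁} ⋯ T_{wₙ}`. -/
def PsNat.word {F : ChFunctor R B C} {ι : Type} (T : ι → PsNat F F) : List ι → PsNat F F
  | [] => PsNat.one F
  | i :: l => (T i).comp (PsNat.word T l)

namespace TwoConn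

variable {E : Type*} [NormedAddCommGroup E] [NormedSpace ℂ E] {E' : Type*}
  [NormedAddCommGroup E'] [NormedSpace ℂ E'] {F : ChFunctor R B C} {ι κ : Type}

/-- The pullback of a 2-connection along `φ`. -/
noncomputable def pullback (N : TwoConn E F ι κ) (φ : E' → E) : TwoConn E' F ι κ where
  α i p := (N.α i (φ p)).comp (fderiv ℂ φ p)
  T := N.T
  β k p X Y := N.β k (φ p) (fderiv ℂ φ p X) (fderiv ℂ φ p Y)
  M := N.M

/-- The scalar coefficient of `T_{w₁} ⋯ T_{wₙ}` in the parallel transport `W_{ba}` along `p`, the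
solution of `∂_b W_{ba} = ħ A(p'(b)) W_{ba}`, `W_{aa} = 1`.  It has order `n` in `ħ`. -/
noncomputable def transport (N : TwoConn E F ι κ) (p : ℝ → E) (a b : ℝ) (w : List ι) : ℂ :=
  iterInt (w.map fun i τ => N.α i (p τ) (deriv p τ)) a b

/-- The coefficient of `ħⁿ` in the 2-holonomy
`W^P = ∫₀¹ ∫₀¹ W_{1r} ħ² Δ[∂P/∂s, ∂P/∂r] W_{r0} dr ds` of the 2-path `(s, r) ↦ P s r`, where `W` is the
parallel transport along `P s`. -/
noncomputable def hol2 [Fintype ι] [Fintype κ] (N : TwoConn E F ι κ) (P : ℝ → ℝ → E) :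
    ℕ → ModTo0 F
  | 0 => 0
  | 1 => 0
  | n + 2 => ∑ m ∈ Finset.HasAntidiagonal.antidiagonal n, ∑ u : Fin m.1 → ι, ∑ k : κ, ∑ u' : Fin m.2 → ι,
      (∫ s in (0 : ℝ)..1, ∫ r in (0 : ℝ)..1,
        N.transport (P s) r 1 (List.ofFn u) *
          N.β k (P s r) (deriv (fun s' => P s' r) s) (deriv (P s) r) *
          N.transport (P s) 0 r (List.ofFn u')) •
        ((N.M k).whiskL (PsNat.word N.T (List.ofFn u))).whiskR (PsNat.word N.T (List.ofFn u'))

end TwoConn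
end TwoConnections

/-! ## The Cirio-Martins-Knizhnik-Zamolodchikov 2-connection -/

section CMKZ

/-- `ω_{ij} = d(zᵢ - zⱼ) / (zᵢ - zⱼ)`. -/
noncomputable def omegaKZ (i j : Fin 3) (z : Fin 3 → ℂ) : (Fin 3 → ℂ) →L[ℂ] ℂ :=
  (z i - z j)⁻¹ • (ContinuousLinearMap.proj (R := ℂ) (φ := fun _ : Fin 3 => ℂ) i -
    ContinuousLinearMap.proj (R := ℂ) (φ := fun _ : Fin 3 => ℂ) j)

/-- The change of coordinates `(z₁, z₂, z₃) = (w, z v + w, v + w)` on the slice `w = 0`. -/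
def coordZV (p : ℂ × ℂ) : Fin 3 → ℂ := ![0, p.1 * p.2, p.2]

open SymStrictMonoidal

variable {R : Type w} [CommRing R] [Algebra ℂ R] {C : Type u} [ChCat.{w, u, v} R C]
  {S : SymStrictMonoidal R C} (t : S.Inf2Braiding)

/-- The 2-connection with `A = ω₁₂ t₁₂ + ω₂₃ t₂₃ + ω₁₃ t₁₃` and
`Δ = 2 (ω₁₂ ∧ ω₃₁ 𝓛 + ω₂₃ ∧ ω₃₁ 𝓡)` on the configuration space of three points `z₁, z₂, z₃ ∈ ℂ`. -/
noncomputable def cmkz : TwoConn (Fin 3 → ℂ) S.tensor2 (Fin 3) (Fin 2) where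
  α := ![omegaKZ 0 1, omegaKZ 1 2, omegaKZ 0 2]
  T := ![t12 t, t23 t, t13 t]
  β := ![fun z X Y => 2 * wedge (omegaKZ 0 1 z) (omegaKZ 2 0 z) X Y,
    fun z X Y => 2 * wedge (omegaKZ 1 2 z) (omegaKZ 2 0 z) X Y]
  M := ![relL t, relR t]

/-- The 2-connection in the coordinates `(z, v)`. -/
noncomputable def cmkzZV : TwoConn (ℂ × ℂ) S.tensor2 (Fin 3) (Fin 2) := (cmkz t).pullback coordZV

/-- `Λ = t₁₂ + t₂₃ + t₁₃`. -/
def bigLambda : PsNat S.tensor2 S.tensor2 := t12 t + t23 t + t13 t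

/-- `D₀(Ξ) = ad_{t₁₂}(Ξ) = t₁₂ Ξ - Ξ t₁₂` and
`D₁(Ξ) = (ad_{t₁₃ - Λ} + Λ)(Ξ) = (t₁₃ - Λ) Ξ - Ξ (t₁₃ - Λ) + Λ Ξ`. -/
def adOp (i : Fin 2) (Ξ : ModTo0 S.tensor2) : ModTo0 S.tensor2 :=
  if i = 0 then Ξ.whiskL (t12 t) - Ξ.whiskR (t12 t)
  else Ξ.whiskL (t13 t - bigLambda t) - Ξ.whiskR (t13 t - bigLambda t) + Ξ.whiskL (bigLambda t)

/-- `Ω₀ = dx / x` and `Ω₁ = dx / (x - 1)`. -/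
noncomputable def Omega (i : Fin 2) (x : ℝ) : ℂ := if i = 0 then 1 / (x : ℂ) else 1 / ((x : ℂ) - 1)

/-- `Λʲ Ξ Λˡ`. -/
def sandwich (j l : ℕ) (Ξ : ModTo0 S.tensor2) : ModTo0 S.tensor2 :=
  (Ξ.whiskL (PsNat.word (fun _ : Unit => bigLambda t) (List.replicate j ()))).whiskR
    (PsNat.word (fun _ : Unit => bigLambda t) (List.replicate l ()))

end CMKZ

/-! ## The 2-paths -/

section TwoPaths

def pathI (ε s : ℝ) : ℝ := ε + s * (1 - 2 * ε)

/-- `c_V ∘ ι`, the path `c_V` traversed backwards. -/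
noncomputable def pathVrev (ε s : ℝ) : ℂ := 1 - 1 / (1 - (pathI ε s : ℂ))

noncomputable def pathIII (ε s : ℝ) : ℂ := 1 / (1 - (pathI ε s : ℂ))

noncomputable def pathIV (ε r : ℝ) : ℂ :=
  1 / 2 + (1 / (ε : ℂ) - 1 / 2) * Complex.exp (-(Complex.I * Real.pi * r))

/-- The vertical coordinate `(1 - c_I(x)) a / (1 - ε)`. -/
noncomputable def vert (a : ℂ) (ε x : ℝ) : ℂ := (1 - (pathI ε x : ℂ)) / (1 - (ε : ℂ)) * a

/-- The path along which `z = c(r)` and `v = (1 - c_I(r)) a / (1 - ε)` vary simultaneously. -/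
noncomputable def pathDiag (c : ℝ → ℂ) (a : ℂ) (ε r : ℝ) : ℂ × ℂ := (c r, vert a ε r)

/-- The 2-path whose `s`-th path first follows `(c, a)` up to `z = c(s)`, then descends vertically until
it meets the diagonal path, which it follows from there on. -/
noncomputable def twoPathDiag (c : ℝ → ℂ) (a : ℂ) (ε s r : ℝ) : ℂ × ℂ :=
  if r ≤ s / 2 then (c (2 * r), a)
  else if r ≤ s then (c s, vert a ε (2 * r - s))
  else pathDiag c a ε r

noncomputable def twoPathV (a : ℂ) (ε : ℝ) : ℝ → ℝ → ℂ × ℂ := twoPathDiag (pathVrev ε) a ε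

noncomputable def twoPathIII (a : ℂ) (ε : ℝ) : ℝ → ℝ → ℂ × ℂ := twoPathDiag (pathIII ε) a ε

/-- The 2-path whose `s`-th path follows `(c_IV, a)` up to `z = c_IV(s)`, then descends vertically and
then follows the rest of `c_IV`. -/
noncomputable def twoPathIV (a : ℂ) (ε s r : ℝ) : ℂ × ℂ :=
  if r ≤ s / 2 then (pathIV ε (2 * r), a)
  else if r ≤ (1 + s) / 2 then (pathIV ε s, vert a ε (2 * r - s))
  else (pathIV ε (2 * r - 1), vert a ε 1)

end TwoPaths

section FV
open SymStrictMonoidal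

variable {R : Type w} [CommRing R] [Algebra ℂ R] {C : Type u} [ChCat.{w, u, v} R C]
  {S : SymStrictMonoidal R C} (t : S.Inf2Braiding)

/-- The coefficient of `ħⁿ` in the series
`f_V(s) = ∑_{q ≥ 0, k ≥ 1} ∑_{i₁, …, i_q} ∑_{0 ≤ j < k} ∫_ε^{c_I(s)} Ω_{i₁} D_{i₁} ⋯ Ω_{i_q} D_{i_q}
  (Λʲ [Ω₀ Ω₁ᵏ 𝓛 - Ω₁ᵏ⁺¹ (𝓛 + 𝓡)] Λᵏ⁻¹⁻ʲ)`,
whose general term has order `q + k + 1`. -/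
noncomputable def fV (ε s : ℝ) : ℕ → ModTo0 S.tensor2
  | 0 => 0
  | 1 => 0
  | n + 2 => ∑ m ∈ Finset.HasAntidiagonal.antidiagonal n, ∑ i : Fin m.1 → Fin 2, ∑ j ∈ Finset.range (m.2 + 1),
      (List.ofFn i).foldr (adOp t) (sandwich t j (m.2 - j)
        (iterInt ((List.ofFn i).map Omega ++ Omega 0 :: List.replicate (m.2 + 1) (Omega 1)) ε
            (pathI ε s) • relL t -
          iterInt ((List.ofFn i).map Omega ++ List.replicate (m.2 + 2) (Omega 1)) ε
            (pathI ε s) • (relL t + relR t)))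

end FV

/-! ### Logarithmic and dilogarithmic integrals on the cut-off interval. -/

section ScalarIntegrals
open MeasureTheory intervalIntegral Set Filter

/-! At order two in `ħ` both parallel transports contribute only their constant term `1`, so the
coefficient of `𝓛` or `𝓡` in a 2-holonomy is the double integral of a scalar 2-form. In the
coordinates `(z, v)` these forms are `dz ∧ dv / (z v)` and `dz ∧ dv / ((z - 1) v)`: products of a
logarithmic form in `z`, with pole at `k = 0` or `1`, and `dv / v`.

Each 2-path depends on `s` only along its vertical leg over `c(s)`; elsewhere `∂P/∂s = 0` and the
form vanishes. On the leg the integral over `r` is that of `dv / v`, the logarithm of the ratio of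
the end heights (`integral_cmkzZV_β`). What remains is a line integral of `dc / (c - k)` against
that logarithm.

For `P_V` and `P_III`, put `x = c_I(s)`. The height factor is `log ((1 - x) / (1 - ε))`, and the
forms `dc / (c - k)` are `dx / x + dx / (1 - x)` for one `k` and `dx / (1 - x)` for the other. Only
`dilogInt` and `logSqInt` occur. The first tends to `∫₀¹ log (1 - x) dx / x = -π² / 6` (Basel
series, `integral_log_one_sub_div`); the second is elementary and equals `-(log ε)² / 2 + o(1)`.
Since `c_III = 1 - ĉ_V`, the two cases differ by exchanging the poles, hence `𝓛` and `𝓡`. The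
order-two part of `f_V(1)` is the single term `q = 0`, `k = 1`, whose iterated integrals are again
`dilogInt` and `-logSqInt`; it equals that of `P_V` for every admissible `ε` (`fV_two`).

For `P_IV` the height factor is the constant `log (ε / (1 - ε))`, and `c_IV` is a lower half circle
passing round both poles, so each integral of `dc / (c - k)` is `-iπ` up to a real term `±log (1 -
ε)` (`integral_dlog_pathIV`). Errors involving `log ε` vanish because `log ε · log (1 - ε) → 0`.

All differences from the asserted values are combinations of the fixed elements `𝓛` and `𝓡` with
coefficients tending to `0`, which gives convergence in the module topology. -/

theorem pathI_zero (ε : ℝ) : pathI ε 0 = ε := by simp [pathI]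

theorem pathI_one (ε : ℝ) : pathI ε 1 = 1 - ε := by simp only [pathI]; ring

theorem pathI_pos {ε x : ℝ} (hε : 0 < ε) (hε' : ε ≤ 1 / 4) (hx : 0 ≤ x) : 0 < pathI ε x := by
  have : 0 ≤ x * (1 - 2 * ε) := mul_nonneg hx (by linarith)
  simp only [pathI]; linarith

theorem pathI_lt_one {ε x : ℝ} (hε : 0 < ε) (hε' : ε ≤ 1 / 4) (hx : x ≤ 1) : pathI ε x < 1 := by
  have : 0 ≤ (1 - x) * (1 - 2 * ε) := mul_nonneg (by linarith) (by linarith)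
  simp only [pathI]; linarith

theorem hasDerivAt_pathI (ε x : ℝ) : HasDerivAt (pathI ε) (1 - 2 * ε) x := by
  have h := ((hasDerivAt_id x).mul_const (1 - 2 * ε)).const_add ε
  rw [one_mul] at h
  exact h

theorem hasDerivAt_ofReal_pathI (ε x : ℝ) :
    HasDerivAt (fun y => (pathI ε y : ℂ)) ((1 - 2 * ε : ℝ) : ℂ) x :=
  (hasDerivAt_pathI ε x).ofReal_comp

/-- The affine substitution `x = c_I(s)`; it turns every integral over the path parameter into one
over `[ε, 1 - ε]`. -/
theorem integral_comp_pathI (ε : ℝ) (f : ℝ → ℝ) :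
    ∫ s in (0 : ℝ)..1, (1 - 2 * ε) * f (pathI ε s) = ∫ x in ε..(1 - ε), f x := by
  have h := intervalIntegral.smul_integral_comp_add_mul (a := 0) (b := 1) f (1 - 2 * ε) ε
  rw [smul_eq_mul, mul_zero, add_zero, mul_one, show ε + (1 - 2 * ε) = 1 - ε by ring] at h
  rw [intervalIntegral.integral_const_mul, ← h]
  simp only [pathI, mul_comm]

/-- `log ((1 - x) / (1 - ε))`. -/
noncomputable def logRatio (ε x : ℝ) : ℝ := Real.log (1 - x) - Real.log (1 - ε)

/-- `∫_ε^{1-ε} log ((1 - x) / (1 - ε)) dx / x`. -/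
noncomputable def dilogInt (ε : ℝ) : ℝ := ∫ x in ε..(1 - ε), 1 / x * logRatio ε x

/-- `∫_ε^{1-ε} log ((1 - x) / (1 - ε)) dx / (1 - x)`. -/
noncomputable def logSqInt (ε : ℝ) : ℝ := ∫ x in ε..(1 - ε), 1 / (1 - x) * logRatio ε x

theorem hasDerivAt_log_one_sub {x : ℝ} (hx : x < 1) :
    HasDerivAt (fun y => Real.log (1 - y)) (-(1 / (1 - x))) x := by
  have := ((hasDerivAt_id x).const_sub 1).log (by simp; linarith)
  simpa [neg_div] using this

/-- Since `dx / (1 - x) = -d logRatio`, a primitive is `-logRatio² / 2`, and `logRatio` vanishes at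
`x = ε`. -/
theorem integral_one_div_one_sub_mul_logRatio {ε : ℝ} (hε : 0 < ε) (hε' : ε ≤ 1 / 4) :
    logSqInt ε = -(Real.log ε - Real.log (1 - ε)) ^ 2 / 2 := by
  have hsub : ∀ x ∈ uIcc ε (1 - ε), x < 1 := by
    intro x hx
    rw [uIcc_of_le (by linarith)] at hx
    linarith [hx.2]
  rw [logSqInt, intervalIntegral.integral_eq_sub_of_hasDerivAt
    (f := fun x => -(logRatio ε x) ^ 2 / 2)]
  · simp [logRatio]
  · intro x hx
    have := (((hasDerivAt_log_one_sub (hsub x hx)).sub_const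
      (Real.log (1 - ε))).pow 2).neg.div_const 2
    refine this.congr_deriv ?_
    simp only [logRatio]
    push_cast
    ring
  · apply ContinuousOn.intervalIntegrable
    unfold logRatio
    have h1 : ∀ x ∈ uIcc ε (1 - ε), 1 - x ≠ 0 := fun x hx => by linarith [hsub x hx]
    have h2 : ContinuousOn (fun x : ℝ => 1 - x) (uIcc ε (1 - ε)) := by fun_prop
    exact (continuousOn_const.div h2 h1).mul ((h2.log h1).sub continuousOn_const)

/-- Termwise integration of `-log (1 - x) / x = ∑ xⁿ / (n + 1)`. The terms are nonnegative on the
interval, so their `L¹` norms are the integrals `1 / (n + 1)²`, which are summable. -/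
theorem hasSum_integral_log_one_sub_div :
    HasSum (fun n : ℕ => (1 : ℝ) / ((n : ℝ) + 1) ^ 2)
      (∫ x in Ioc (0 : ℝ) 1, -(Real.log (1 - x) / x)) := by
  have hI : ∀ n : ℕ, ∫ x in Ioc (0 : ℝ) 1, x ^ n / ((n : ℝ) + 1) = 1 / ((n : ℝ) + 1) ^ 2 := by
    intro n
    rw [← intervalIntegral.integral_of_le zero_le_one, intervalIntegral.integral_div, integral_pow]
    simp
    field_simp
  have hs : Summable (fun n : ℕ => (1 : ℝ) / ((n : ℝ) + 1) ^ 2) := by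
    have := (summable_nat_add_iff 1).2 hasSum_zeta_two.summable
    simpa using this
  have key := hasSum_integral_of_summable_integral_norm (μ := volume.restrict (Ioc (0 : ℝ) 1))
    (F := fun (n : ℕ) (x : ℝ) => x ^ n / ((n : ℝ) + 1))
    (fun n => (Continuous.integrableOn_Ioc (by fun_prop)))
    (by
      refine hs.congr fun n => ?_
      rw [← hI n]
      refine setIntegral_congr_fun measurableSet_Ioc fun x hx => ?_
      have := hx.1
      simp only [Real.norm_eq_abs]
      rw [abs_of_nonneg (by positivity)])
  simp only [hI] at key
  suffices h : ∫ x in Ioc (0 : ℝ) 1, -(Real.log (1 - x) / x) =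
      ∫ x in Ioc (0 : ℝ) 1, ∑' n : ℕ, x ^ n / ((n : ℝ) + 1) by rwa [h]
  -- The endpoint `x = 1`, where the power series diverges, is discarded as a null set.
  rw [integral_Ioc_eq_integral_Ioo, integral_Ioc_eq_integral_Ioo]
  refine setIntegral_congr_fun measurableSet_Ioo fun x hx => ?_
  have h := (Real.hasSum_pow_div_log_of_abs_lt_one (x := x)
    (by rw [abs_of_pos hx.1]; exact hx.2)).div_const x
  have hx0 : x ≠ 0 := hx.1.ne'
  have h' : HasSum (fun n : ℕ => x ^ n / ((n : ℝ) + 1)) (-Real.log (1 - x) / x) := by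
    have e : (fun n : ℕ => x ^ n / ((n : ℝ) + 1)) = fun n : ℕ => x ^ (n + 1) / ((n : ℝ) + 1) / x := by
      funext n
      rw [pow_succ]
      field_simp
    rwa [e]
  simp only [h'.tsum_eq, neg_div]

theorem integral_log_one_sub_div :
    ∫ x in (0 : ℝ)..1, Real.log (1 - x) / x = -(Real.pi ^ 2 / 6) := by
  -- The Basel series is indexed from `0` with the term `1 / 0² = 0`; dropping it shifts the index.
  have h1 := (hasSum_nat_add_iff' 1).2 hasSum_zeta_two
  have h2 := hasSum_integral_log_one_sub_div.unique (by simpa using h1)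
  rw [MeasureTheory.integral_neg] at h2
  rw [intervalIntegral.integral_of_le zero_le_one]
  linarith

/-- A non-integrable function has integral `0` by convention, whereas the integral just computed is
`-π² / 6 ≠ 0`. -/
theorem intervalIntegrable_log_one_sub_div :
    IntervalIntegrable (fun x : ℝ => Real.log (1 - x) / x) volume 0 1 := by
  by_contra h
  have := intervalIntegral.integral_undef h
  rw [integral_log_one_sub_div] at this
  have := Real.pi_pos
  nlinarith

/-- The integrand is integrable on all of `[0, 1]`, so its primitive is continuous up to both
endpoints, and both cut-offs may be removed at once. -/
theorem tendsto_integral_log_one_sub_div :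
    Tendsto (fun ε : ℝ => ∫ x in ε..(1 - ε), Real.log (1 - x) / x) (𝓝[>] 0)
      (𝓝 (-(Real.pi ^ 2 / 6))) := by
  have hi := intervalIntegrable_log_one_sub_div
  have hc : ContinuousOn (fun y : ℝ => ∫ x in (0 : ℝ)..y, Real.log (1 - x) / x) (Icc 0 1) := by
    have := intervalIntegral.continuousOn_primitive_interval
      (μ := volume) (f := fun x : ℝ => Real.log (1 - x) / x) (a := 0) (b := 1)
      (by rw [uIcc_of_le zero_le_one, integrableOn_Icc_iff_integrableOn_Ioc]; exact
            (intervalIntegrable_iff_integrableOn_Ioc_of_le zero_le_one).1 hi)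
    rwa [uIcc_of_le zero_le_one] at this
  have hmem : ∀ᶠ ε : ℝ in 𝓝[>] 0, ε ∈ Ioo (0 : ℝ) 1 := Ioo_mem_nhdsGT one_pos
  have h0 : Tendsto (fun ε : ℝ => ε) (𝓝[>] 0) (𝓝[Icc 0 1] 0) :=
    tendsto_nhdsWithin_iff.2 ⟨tendsto_nhdsWithin_of_tendsto_nhds tendsto_id,
      hmem.mono fun ε h => ⟨h.1.le, h.2.le⟩⟩
  have h1 : Tendsto (fun ε : ℝ => 1 - ε) (𝓝[>] 0) (𝓝[Icc 0 1] 1) := by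
    refine tendsto_nhdsWithin_iff.2 ⟨tendsto_nhdsWithin_of_tendsto_nhds ?_,
      hmem.mono fun ε h => ⟨by linarith [h.2], by linarith [h.1]⟩⟩
    have : Continuous fun ε : ℝ => 1 - ε := by fun_prop
    simpa using this.tendsto 0
  have k1 := (hc 1 (by simp)).tendsto.comp h1
  have k0 := (hc 0 (by simp)).tendsto.comp h0
  have := k1.sub k0
  rw [intervalIntegral.integral_same, sub_zero, integral_log_one_sub_div] at this
  refine this.congr' (hmem.mono fun ε h => ?_)
  have sub : ∀ y ∈ Icc (0 : ℝ) 1,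
      IntervalIntegrable (fun x : ℝ => Real.log (1 - x) / x) volume 0 y := fun y hy =>
    hi.mono_set (by rw [uIcc_of_le hy.1, uIcc_of_le zero_le_one]; exact Icc_subset_Icc_right hy.2)
  exact intervalIntegral.integral_interval_sub_left
    (sub _ ⟨by linarith [h.2], by linarith [h.1]⟩) (sub _ ⟨h.1.le, h.2.le⟩)

theorem tendsto_log_one_sub : Tendsto (fun ε : ℝ => Real.log (1 - ε)) (𝓝[>] 0) (𝓝 0) := by
  have := (hasDerivAt_log_one_sub one_pos).continuousAt.tendsto
  simp only [sub_zero, Real.log_one] at this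
  exact tendsto_nhdsWithin_of_tendsto_nhds this

/-- Differentiability of `log (1 - ε)` at `0` gives `log (1 - ε) = O(ε)`, and `ε log ε → 0`. -/
theorem tendsto_log_mul_log_one_sub :
    Tendsto (fun ε : ℝ => Real.log ε * Real.log (1 - ε)) (𝓝[>] 0) (𝓝 0) := by
  have h1 : (fun ε : ℝ => Real.log (1 - ε)) =O[𝓝[>] 0] fun ε : ℝ => ε := by
    have := (hasDerivAt_log_one_sub one_pos).isBigO_sub
    simp only [sub_zero, Real.log_one] at this
    exact this.mono nhdsWithin_le_nhds
  exact ((Asymptotics.isBigO_refl Real.log _).mul h1).trans_tendsto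
    (by simpa using tendsto_log_mul_rpow_nhdsGT_zero one_pos)

/-- Separates the normalizing constant `log (1 - ε)` of `logRatio`, which is integrated against `dx
/ x`; its contribution tends to `0`. -/
theorem dilogInt_eq {ε : ℝ} (hε : 0 < ε) (hε' : ε ≤ 1 / 4) :
    dilogInt ε = (∫ x in ε..(1 - ε), Real.log (1 - x) / x) -
      Real.log (1 - ε) * (Real.log (1 - ε) - Real.log ε) := by
  have h0 : (0 : ℝ) ∉ uIcc ε (1 - ε) := by
    rw [uIcc_of_le (by linarith)]
    exact fun h => by linarith [h.1]
  have hi : IntervalIntegrable (fun x : ℝ => x⁻¹) volume ε (1 - ε) :=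
    intervalIntegrable_inv (fun x hx h => h0 (h ▸ hx)) continuousOn_id
  have hl : IntervalIntegrable (fun x : ℝ => Real.log (1 - x) / x) volume ε (1 - ε) :=
    intervalIntegrable_log_one_sub_div.mono_set (by
      rw [uIcc_of_le (by linarith), uIcc_of_le zero_le_one]
      exact Icc_subset_Icc hε.le (by linarith))
  have e : ∀ x : ℝ, 1 / x * logRatio ε x = Real.log (1 - x) / x - Real.log (1 - ε) * x⁻¹ :=
    fun x => by simp only [logRatio]; ring
  simp only [dilogInt, e]
  rw [intervalIntegral.integral_sub hl (hi.const_mul _), intervalIntegral.integral_const_mul,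
    integral_inv h0, Real.log_div (by linarith) hε.ne']

theorem eventually_small : ∀ᶠ ε : ℝ in 𝓝[>] 0, 0 < ε ∧ ε ≤ 1 / 4 :=
  (Ioc_mem_nhdsGT (by norm_num : (0 : ℝ) < 1 / 4) : _)

theorem tendsto_dilogInt :
    Tendsto (fun ε => dilogInt ε + Real.pi ^ 2 / 6) (𝓝[>] 0) (𝓝 0) := by
  have h := (tendsto_integral_log_one_sub_div.sub
    ((tendsto_log_one_sub.mul tendsto_log_one_sub).sub tendsto_log_mul_log_one_sub)).add_const
      (Real.pi ^ 2 / 6)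
  rw [show -(Real.pi ^ 2 / 6) - (0 * 0 - 0) + Real.pi ^ 2 / 6 = 0 by ring] at h
  refine h.congr' (eventually_small.mono fun ε hε => ?_)
  beta_reduce
  rw [dilogInt_eq hε.1 hε.2]
  ring

theorem tendsto_logSqInt :
    Tendsto (fun ε => logSqInt ε + Real.log ε ^ 2 / 2) (𝓝[>] 0) (𝓝 0) := by
  have h := tendsto_log_mul_log_one_sub.sub
    ((tendsto_log_one_sub.mul tendsto_log_one_sub).div_const 2)
  rw [show (0 : ℝ) - 0 * 0 / 2 = 0 by ring] at h
  refine h.congr' (eventually_small.mono fun ε hε => ?_)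
  beta_reduce
  rw [integral_one_div_one_sub_mul_logRatio hε.1 hε.2]
  ring

end ScalarIntegrals

/-! ### The scalar 2-forms of the connection in the coordinates `(z, v)`. -/

section Holonomy
open MeasureTheory intervalIntegral Set Filter SymStrictMonoidal

theorem hasFDerivAt_coordZV (p : ℂ × ℂ) :
    HasFDerivAt coordZV (ContinuousLinearMap.pi
      ![0, p.1 • ContinuousLinearMap.snd ℂ ℂ ℂ + p.2 • ContinuousLinearMap.fst ℂ ℂ ℂ,
        ContinuousLinearMap.snd ℂ ℂ ℂ]) p := by
  rw [hasFDerivAt_pi']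
  intro i
  fin_cases i
  · exact hasFDerivAt_const 0 p
  · exact hasFDerivAt_fst.mul hasFDerivAt_snd
  · exact hasFDerivAt_snd

variable {R : Type w} [CommRing R] {C : Type u} [ChCat.{w, u, v} R C]
  {S : SymStrictMonoidal R C} (t : S.Inf2Braiding)

/-- In the coordinates `(z, v)`, the scalar 2-forms of the 2-connection are `dz ∧ dv / ((z - k) v)`
up to the normalization of the wedge product. -/
theorem cmkzZV_β (k : Fin 2) (p X Y : ℂ × ℂ) (h1 : p.1 ≠ 0) (h2 : p.1 ≠ 1) (h3 : p.2 ≠ 0) :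
    (cmkzZV t).β k p X Y = (X.1 * Y.2 - Y.1 * X.2) / ((p.1 - (k : ℕ)) * p.2) := by
  have h4 : p.1 - 1 ≠ 0 := sub_ne_zero.2 h2
  -- This is `z₂ - z₃ = (z - 1) v`, the denominator of `ω₂₃`.
  have h5 : p.1 * p.2 - p.2 ≠ 0 := by
    rw [← sub_one_mul]
    exact mul_ne_zero h4 h3
  -- Pulled back, `ω₁₂ = dz / z + dv / v`, `ω₂₃ = dz / (z - 1) + dv / v` and `ω₃₁ = dv / v`. The `dv
  -- ∧ dv` parts cancel, and the prefactor `2` removes the `1 / 2` of `wedge`.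
  simp only [cmkzZV, TwoConn.pullback, (hasFDerivAt_coordZV p).fderiv]
  fin_cases k
  · simp [cmkz, wedge, omegaKZ, coordZV]
    field_simp
    ring
  · simp [cmkz, wedge, omegaKZ, coordZV]
    field_simp
    ring

/-- Used where the 2-path is stationary in `s`; no condition on the base point is needed there. -/
theorem cmkzZV_β_zero_left (k : Fin 2) (p Y : ℂ × ℂ) : (cmkzZV t).β k p 0 Y = 0 := by
  simp only [cmkzZV, TwoConn.pullback, map_zero]
  fin_cases k <;> simp [cmkz, wedge]

end Holonomy

/-! ### Unit laws and the order-two coefficient of the 2-holonomy. -/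

section Whiskering
variable {R : Type w} [CommRing R] {B : Type u} [ChCat.{w, u, v} R B] {C : Type u'}
  [ChCat.{w, u', v'} R C] {F G : ChFunctor R B C}

theorem PsNat.one_comp (ξ : PsNat F G) : (PsNat.one G).comp ξ = ξ := by
  refine Subtype.ext (Prod.ext (funext fun U => one_c00 _) (funext fun U => funext fun V => ?_))
  ext f
  -- The homotopy of the identity transformation is `0`, so only one of the two summands of the
  -- composite homotopy survives.
  change c10 0 (ξ.app U) + c01 (ChCat.one (G.obj V)) (ξ.hot f) = ξ.hot f
  rw [one_c01, map_zero, LinearMap.zero_apply, zero_add]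

theorem PsNat.comp_one (ξ : PsNat F G) : ξ.comp (PsNat.one F) = ξ := by
  refine Subtype.ext (Prod.ext (funext fun U => c00_one _) (funext fun U => funext fun V => ?_))
  ext f
  change c10 (ξ.hot f) (ChCat.one (F.obj U)) + c01 (ξ.app V) 0 = ξ.hot f
  rw [c10_one, map_zero, add_zero]

/-- An element of `ModTo0` carries its source, so the unit law is needed for the source as well as
for the components. -/
theorem ModTo0.whiskL_one (Ξ : ModTo0 F) : Ξ.whiskL (PsNat.one F) = Ξ :=
  Subtype.ext (Prod.ext (PsNat.one_comp Ξ.src) (funext fun U => one_c01 (Ξ.app U)))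

theorem ModTo0.whiskR_one (Ξ : ModTo0 F) : Ξ.whiskR (PsNat.one F) = Ξ :=
  Subtype.ext (Prod.ext (PsNat.comp_one Ξ.src) (funext fun U => c10_one (Ξ.app U)))

/-- At this order both transport words are empty: their iterated integrals are `1` and their
composites are identities. -/
theorem TwoConn.hol2_two [Algebra ℂ R] {E : Type*} [NormedAddCommGroup E] [NormedSpace ℂ E]
    {ι κ : Type} [Fintype ι] [Fintype κ] (N : TwoConn E F ι κ) (P : ℝ → ℝ → E) :
    N.hol2 P 2 = ∑ k : κ, (∫ s in (0 : ℝ)..1, ∫ r in (0 : ℝ)..1,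
      N.β k (P s r) (deriv (fun s' => P s' r) s) (deriv (P s) r)) • N.M k := by
  simp [TwoConn.hol2, TwoConn.transport, iterInt, PsNat.word, ModTo0.whiskL_one,
    ModTo0.whiskR_one]

end Whiskering

/-! ### Reduction of the double integrals to line integrals along the base curve. -/

section TwoPathHolonomy
open MeasureTheory intervalIntegral Set Filter SymStrictMonoidal

theorem hasDerivAt_vert (a : ℂ) (ε x : ℝ) :
    HasDerivAt (vert a ε) (-((1 - 2 * ε : ℝ) : ℂ) / (1 - (ε : ℂ)) * a) x :=
  (((hasDerivAt_ofReal_pathI ε x).const_sub 1).div_const _).mul_const a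

theorem one_sub_ofReal_pathI_ne_zero {ε x : ℝ} (hε : 0 < ε) (hε' : ε ≤ 1 / 4) (hx : x ≤ 1) :
    1 - (pathI ε x : ℂ) ≠ 0 := by
  have := pathI_lt_one hε hε' hx
  exact_mod_cast (sub_pos.2 this).ne'

theorem one_sub_ofReal_ne_zero {ε : ℝ} (hε' : ε ≤ 1 / 4) : 1 - (ε : ℂ) ≠ 0 := by
  have : (1 : ℝ) - ε ≠ 0 := by linarith
  exact_mod_cast this

theorem vert_ne_zero {a : ℂ} (ha : a ≠ 0) {ε x : ℝ} (hε : 0 < ε) (hε' : ε ≤ 1 / 4) (hx : x ≤ 1) :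
    vert a ε x ≠ 0 :=
  mul_ne_zero (div_ne_zero (one_sub_ofReal_pathI_ne_zero hε hε' hx) (one_sub_ofReal_ne_zero hε')) ha

theorem hasDerivAt_two_mul_sub (s r : ℝ) : HasDerivAt (fun r => 2 * r - s) 2 r := by
  simpa using ((hasDerivAt_id r).const_mul 2).sub_const s

/-- The integrand is the derivative of `log (1 - c_I(2r - s))`, that is, the logarithmic derivative
of the height of the vertical leg. The leg starts at height parameter `0`, where `c_I = ε`; the
bound `2 * m - s ≤ 1` keeps the logarithm's argument positive. -/
theorem integral_dlog_vert {ε s m : ℝ} (hε : 0 < ε) (hε' : ε ≤ 1 / 4) (hm : s / 2 ≤ m)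
    (hm' : 2 * m - s ≤ 1) :
    ∫ r in (s / 2)..m, 2 * (-(1 - 2 * ε) / (1 - pathI ε (2 * r - s))) =
      logRatio ε (pathI ε (2 * m - s)) := by
  have hlt : ∀ r ∈ uIcc (s / 2) m, 1 - pathI ε (2 * r - s) ≠ 0 := by
    intro r hr
    rw [uIcc_of_le hm] at hr
    exact (sub_pos.2 (pathI_lt_one hε hε' (by linarith [hr.2]))).ne'
  rw [intervalIntegral.integral_eq_sub_of_hasDerivAt
    (f := fun r => Real.log (1 - pathI ε (2 * r - s)))]
  · rw [show 2 * (s / 2) - s = 0 by ring, pathI_zero, logRatio]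
  · intro r hr
    have h : HasDerivAt (fun r => pathI ε (2 * r - s)) ((1 - 2 * ε) * 2) r :=
      HasDerivAt.comp (h₂ := pathI ε) r (hasDerivAt_pathI ε _) (hasDerivAt_two_mul_sub s r)
    refine ((h.const_sub 1).log (hlt r hr)).congr_deriv ?_
    ring
  · apply ContinuousOn.intervalIntegrable
    refine continuousOn_const.mul (continuousOn_const.div ?_ hlt)
    unfold pathI
    fun_prop

variable {R : Type w} [CommRing R] {C : Type u} [ChCat.{w, u, v} R C]
  {S : SymStrictMonoidal R C} (t : S.Inf2Braiding)

/-- The inner integral of the holonomy of order two along a path which first does not depend on `s`,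
then descends vertically over `c s` until the parameter `m`, and then does not depend on `s`. -/
theorem integral_cmkzZV_β (k : Fin 2) {a : ℂ} (ha : a ≠ 0) {ε s m : ℝ} (hε : 0 < ε)
    (hε' : ε ≤ 1 / 4) (hs : 0 < s) (hm : s / 2 ≤ m) (hm1 : m ≤ 1) (hm' : 2 * m - s ≤ 1)
    {c : ℝ → ℂ} {c' : ℂ} (hc : HasDerivAt c c' s) (hc0 : c s ≠ 0) (hc1 : c s ≠ 1)
    {P : ℝ → ℝ → ℂ × ℂ} (hl : ∀ r, r < s / 2 → ∀ᶠ s' in 𝓝 s, P s' r = P s r)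
    (hr : ∀ r, m < r → ∀ᶠ s' in 𝓝 s, P s' r = P s r)
    (hmid : ∀ r, s / 2 < r → r < m →
      (∀ᶠ s' in 𝓝 s, P s' r = (c s', vert a ε (2 * r - s'))) ∧
      ∀ᶠ r' in 𝓝 r, P s r' = (c s, vert a ε (2 * r' - s))) :
    ∫ r in (0 : ℝ)..1, (cmkzZV t).β k (P s r) (deriv (fun s' => P s' r) s) (deriv (P s) r) =
      c' / (c s - (k : ℕ)) * (logRatio ε (pathI ε (2 * m - s)) : ℂ) := by
  set f : ℝ → ℂ := fun r =>
    (cmkzZV t).β k (P s r) (deriv (fun s' => P s' r) s) (deriv (P s) r) with hf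
  -- Where the path does not move with `s`, the first tangent vector is zero.
  have hconst : ∀ r, (∀ᶠ s' in 𝓝 s, P s' r = P s r) → f r = 0 := by
    intro r h
    have : deriv (fun s' => P s' r) s = 0 := by
      rw [Filter.EventuallyEq.deriv_eq (f := fun _ => P s r) h, deriv_const]
    simp only [hf, this, cmkzZV_β_zero_left]
  have hmidf : ∀ r, s / 2 < r → r < m → f r = c' / (c s - (k : ℕ)) *
      ((2 * (-(1 - 2 * ε) / (1 - pathI ε (2 * r - s))) : ℝ) : ℂ) := by
    intro r h1 h2
    obtain ⟨e1, e2⟩ := hmid r h1 h2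
    -- The `v`-component of `∂P/∂s` plays no role in the end: `∂P/∂r` has zero `z`-component, so the
    -- form evaluates to `c'` times the `v`-component of `∂P/∂r`.
    have d1 : HasDerivAt (fun s' => P s' r)
        (c', (-1 : ℝ) • (-((1 - 2 * ε : ℝ) : ℂ) / (1 - (ε : ℂ)) * a)) s := by
      refine HasDerivAt.congr_of_eventuallyEq ?_ e1
      exact hc.prodMk ((hasDerivAt_vert a ε (2 * r - s)).scomp s
        ((hasDerivAt_id s).const_sub (2 * r)))
    have d2 : HasDerivAt (P s)
        (0, (2 : ℝ) • (-((1 - 2 * ε : ℝ) : ℂ) / (1 - (ε : ℂ)) * a)) r := by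
      refine HasDerivAt.congr_of_eventuallyEq ?_ e2
      exact (hasDerivAt_const r (c s)).prodMk (HasDerivAt.scomp (g₁ := vert a ε) r
        (hasDerivAt_vert a ε _) (hasDerivAt_two_mul_sub s r))
    have hx : 2 * r - s ≤ 1 := by linarith
    have hv := vert_ne_zero ha hε hε' hx
    simp only [hf, d1.deriv, d2.deriv, e2.self_of_nhds]
    rw [cmkzZV_β t k _ _ _ hc0 hc1 hv]
    have n1 := one_sub_ofReal_pathI_ne_zero hε hε' hx
    have n2 := one_sub_ofReal_ne_zero hε'
    have n3 : c s - (k : ℕ) ≠ 0 := by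
      fin_cases k
      · simpa using hc0
      · simpa using sub_ne_zero.2 hc1
    -- The constants `a` and `1 - ε` in the height cancel in its logarithmic derivative.
    simp only [vert, Complex.real_smul]
    push_cast
    field_simp
    ring
  set g : ℝ → ℂ := fun r => c' / (c s - (k : ℕ)) *
      ((2 * (-(1 - 2 * ε) / (1 - pathI ε (2 * r - s))) : ℝ) : ℂ) with hg
  -- The two corners `r = s / 2` and `r = m`, where the derivatives are not under control, form a
  -- null set.
  have hfg : f =ᵐ[volume.restrict (Ioc 0 1)] (Ioo (s / 2) m).indicator g := by
    refine ae_restrict_of_ae ?_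
    filter_upwards [(Set.toFinite {s / 2, m}).countable.ae_notMem volume] with r hrn
    simp only [mem_insert_iff, mem_singleton_iff, not_or] at hrn
    rcases lt_or_gt_of_ne hrn.1 with h1 | h1
    · rw [hconst r (hl r h1), indicator_of_notMem (fun h => h1.not_gt h.1)]
    · rcases lt_or_gt_of_ne hrn.2 with h2 | h2
      · rw [hmidf r h1 h2, indicator_of_mem (show r ∈ Ioo (s / 2) m from ⟨h1, h2⟩)]
      · rw [hconst r (hr r h2), indicator_of_notMem (fun h => h2.not_gt h.2)]
  have hsub : Ioo (s / 2) m ⊆ Ioc 0 1 := fun r h => ⟨by linarith [h.1], by linarith [h.2]⟩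
  rw [intervalIntegral.integral_of_le zero_le_one, integral_congr_ae hfg,
    setIntegral_indicator measurableSet_Ioo, inter_eq_right.2 hsub,
    ← integral_Ioc_eq_integral_Ioo, ← intervalIntegral.integral_of_le hm, hg,
    intervalIntegral.integral_const_mul, intervalIntegral.integral_ofReal,
    integral_dlog_vert hε hε' hm hm']

/-- The holonomy of order two in terms of the scalar double integrals of the two 2-forms. -/
theorem hol2_two_eq [Algebra ℂ R] {P : ℝ → ℝ → ℂ × ℂ} {I : Fin 2 → ℂ}
    (hI : ∀ k, ∫ s in (0 : ℝ)..1, ∫ r in (0 : ℝ)..1,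
      (cmkzZV t).β k (P s r) (deriv (fun s' => P s' r) s) (deriv (P s) r) = I k) :
    (cmkzZV t).hol2 P 2 = I 0 • relL t + I 1 • relR t := by
  rw [TwoConn.hol2_two, Fin.sum_univ_two, hI, hI]
  rfl

/-- Allows the endpoints of the parameter interval to be ignored, where the 2-paths may degenerate.
-/
theorem integral_zero_one_congr {f g : ℝ → ℂ} (h : ∀ s, 0 < s → s < 1 → f s = g s) :
    ∫ s in (0 : ℝ)..1, f s = ∫ s in (0 : ℝ)..1, g s := by
  rw [intervalIntegral.integral_of_le zero_le_one, intervalIntegral.integral_of_le zero_le_one,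
    integral_Ioc_eq_integral_Ioo, integral_Ioc_eq_integral_Ioo]
  exact setIntegral_congr_fun measurableSet_Ioo fun s hs => h s hs.1 hs.2

/-- The vertical leg ends at `r = m = s`, on the diagonal path, so its final height parameter `2 * m
- s` is `s` itself. -/
theorem integral_twoPathDiag (k : Fin 2) {a : ℂ} (ha : a ≠ 0) {ε : ℝ} (hε : 0 < ε)
    (hε' : ε ≤ 1 / 4) {c c' : ℝ → ℂ} (hc : ∀ s, 0 < s → s < 1 → HasDerivAt c (c' s) s)
    (hc0 : ∀ s, 0 < s → s < 1 → c s ≠ 0) (hc1 : ∀ s, 0 < s → s < 1 → c s ≠ 1) :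
    ∫ s in (0 : ℝ)..1, ∫ r in (0 : ℝ)..1, (cmkzZV t).β k (twoPathDiag c a ε s r)
      (deriv (fun s' => twoPathDiag c a ε s' r) s) (deriv (twoPathDiag c a ε s) r) =
      ∫ s in (0 : ℝ)..1, c' s / (c s - (k : ℕ)) * (logRatio ε (pathI ε s) : ℂ) := by
  refine integral_zero_one_congr fun s h0 h1 => ?_
  have e : 2 * s - s = s := by ring
  rw [integral_cmkzZV_β t k ha hε hε' h0 (m := s) (by linarith) h1.le (by linarith) (hc s h0 h1)
    (hc0 s h0 h1) (hc1 s h0 h1), e]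
  · intro r hr
    filter_upwards [lt_mem_nhds (show 2 * r < s by linarith)] with s' hs'
    simp only [twoPathDiag]
    rw [if_pos (by linarith), if_pos hr.le]
  · intro r hr
    -- Positivity of `s'` turns `s' < r` into `s' / 2 < r`, so the nearby paths are on their third
    -- piece too.
    filter_upwards [gt_mem_nhds hr, lt_mem_nhds h0] with s' hs' hs0
    simp only [twoPathDiag]
    rw [if_neg (by linarith), if_neg (by linarith), if_neg (by linarith), if_neg (by linarith)]
  · intro r hr hr'
    constructor
    · filter_upwards [gt_mem_nhds (show s < 2 * r by linarith), lt_mem_nhds hr'] with s' hs' hs0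
      simp only [twoPathDiag]
      rw [if_neg (by linarith), if_pos hs0.le]
    · filter_upwards [lt_mem_nhds hr, gt_mem_nhds hr'] with r' h1 h2
      simp only [twoPathDiag]
      rw [if_neg (by linarith), if_pos h2.le]

/-- Here `m = (1 + s) / 2`: every vertical leg has full length and ends at height parameter `1`, so
the height factor is independent of `s` and comes out of the integral. -/
theorem integral_twoPathIV (k : Fin 2) {a : ℂ} (ha : a ≠ 0) {ε : ℝ} (hε : 0 < ε)
    (hε' : ε ≤ 1 / 4) {c' : ℝ → ℂ} (hc : ∀ s, HasDerivAt (pathIV ε) (c' s) s)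
    (hc0 : ∀ s, 0 < s → s < 1 → pathIV ε s ≠ 0) (hc1 : ∀ s, 0 < s → s < 1 → pathIV ε s ≠ 1) :
    ∫ s in (0 : ℝ)..1, ∫ r in (0 : ℝ)..1, (cmkzZV t).β k (twoPathIV a ε s r)
      (deriv (fun s' => twoPathIV a ε s' r) s) (deriv (twoPathIV a ε s) r) =
      (∫ s in (0 : ℝ)..1, c' s / (pathIV ε s - (k : ℕ))) * (logRatio ε (1 - ε) : ℂ) := by
  rw [← intervalIntegral.integral_mul_const]
  refine integral_zero_one_congr fun s h0 h1 => ?_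
  have e : 2 * ((1 + s) / 2) - s = 1 := by ring
  rw [integral_cmkzZV_β t k ha hε hε' h0 (m := (1 + s) / 2) (by linarith) (by linarith) e.le
    (hc s) (hc0 s h0 h1) (hc1 s h0 h1), e, pathI_one]
  · intro r hr
    filter_upwards [lt_mem_nhds (show 2 * r < s by linarith)] with s' hs'
    simp only [twoPathIV]
    rw [if_pos (by linarith), if_pos hr.le]
  · intro r hr
    filter_upwards [gt_mem_nhds (show s < 2 * r - 1 by linarith), lt_mem_nhds h0, gt_mem_nhds h1]
      with s' hs' hs0 hs1
    simp only [twoPathIV]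
    rw [if_neg (by linarith), if_neg (by linarith), if_neg (by linarith), if_neg (by linarith)]
  · intro r hr hr'
    constructor
    · filter_upwards [gt_mem_nhds (show s < 2 * r by linarith),
        lt_mem_nhds (show 2 * r - 1 < s by linarith)] with s' hs' hs0
      simp only [twoPathIV]
      rw [if_neg (by linarith), if_pos (by linarith)]
    · filter_upwards [lt_mem_nhds hr, gt_mem_nhds hr'] with r' h1 h2
      simp only [twoPathIV]
      rw [if_neg (by linarith), if_pos h2.le]

end TwoPathHolonomy

/-! ### The base curves of the three 2-paths, the series `f_V`, and the limits. -/

section PathIntegrals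
open MeasureTheory intervalIntegral Set Filter SymStrictMonoidal

theorem hasDerivAt_pathIII {ε s : ℝ} (hε : 0 < ε) (hε' : ε ≤ 1 / 4) (hs : s ≤ 1) :
    HasDerivAt (pathIII ε) ((1 - 2 * ε : ℝ) / (1 - (pathI ε s : ℂ)) ^ 2) s := by
  have h := ((hasDerivAt_ofReal_pathI ε s).const_sub 1).fun_inv
    (one_sub_ofReal_pathI_ne_zero hε hε' hs)
  have e : pathIII ε = fun y => (1 - (pathI ε y : ℂ))⁻¹ := funext fun y => one_div _
  rw [e]
  exact h.congr_deriv (by rw [neg_neg])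

theorem hasDerivAt_pathVrev {ε s : ℝ} (hε : 0 < ε) (hε' : ε ≤ 1 / 4) (hs : s ≤ 1) :
    HasDerivAt (pathVrev ε) (-((1 - 2 * ε : ℝ) / (1 - (pathI ε s : ℂ)) ^ 2)) s :=
  (hasDerivAt_pathIII hε hε' hs).const_sub 1

theorem pathVrev_ne_one {ε s : ℝ} (hε : 0 < ε) (hε' : ε ≤ 1 / 4) (hs : s ≤ 1) :
    pathVrev ε s ≠ 1 := by
  simpa [pathVrev] using one_sub_ofReal_pathI_ne_zero hε hε' hs

theorem pathIII_ne_zero {ε s : ℝ} (hε : 0 < ε) (hε' : ε ≤ 1 / 4) (hs : s ≤ 1) :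
    pathIII ε s ≠ 0 := by
  simpa [pathIII] using one_sub_ofReal_pathI_ne_zero hε hε' hs

theorem ofReal_pathI_ne_zero {ε s : ℝ} (hε : 0 < ε) (hε' : ε ≤ 1 / 4) (hs : 0 ≤ s) :
    (pathI ε s : ℂ) ≠ 0 := by
  exact_mod_cast (pathI_pos hε hε' hs).ne'

theorem pathIII_ne_one {ε s : ℝ} (hε : 0 < ε) (hε' : ε ≤ 1 / 4) (h0 : 0 ≤ s) (hs : s ≤ 1) :
    pathIII ε s ≠ 1 := by
  have h1 := one_sub_ofReal_pathI_ne_zero hε hε' hs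
  have h2 := ofReal_pathI_ne_zero hε hε' h0
  rw [pathIII, Ne, div_eq_one_iff_eq h1]
  intro h
  exact h2 (by linear_combination h)

theorem pathVrev_ne_zero {ε s : ℝ} (hε : 0 < ε) (hε' : ε ≤ 1 / 4) (h0 : 0 ≤ s) (hs : s ≤ 1) :
    pathVrev ε s ≠ 0 :=
  fun h => pathIII_ne_one hε hε' h0 hs (sub_eq_zero.1 h).symm

theorem integral_pathI_logSqInt (ε : ℝ) :
    ∫ s in (0 : ℝ)..1, (((1 - 2 * ε) * (1 / (1 - pathI ε s) * logRatio ε (pathI ε s)) : ℝ) : ℂ) =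
      logSqInt ε := by
  rw [intervalIntegral.integral_ofReal,
    integral_comp_pathI ε (fun x => 1 / (1 - x) * logRatio ε x), logSqInt]

theorem integral_pathI_dilogInt {ε : ℝ} (hε : 0 < ε) (hε' : ε ≤ 1 / 4) :
    ∫ s in (0 : ℝ)..1, (((1 - 2 * ε) * (1 / pathI ε s * logRatio ε (pathI ε s) +
      1 / (1 - pathI ε s) * logRatio ε (pathI ε s)) : ℝ) : ℂ) =
      (dilogInt ε + logSqInt ε : ℝ) := by
  rw [intervalIntegral.integral_ofReal, integral_comp_pathI ε
    (fun x => 1 / x * logRatio ε x + 1 / (1 - x) * logRatio ε x), dilogInt, logSqInt,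
    intervalIntegral.integral_add]
  all_goals
    apply ContinuousOn.intervalIntegrable
    rw [uIcc_of_le (by linarith)]
    unfold logRatio
    have h1 : ∀ x ∈ Icc ε (1 - ε), 1 - x ≠ 0 := fun x hx => by linarith [hx.2]
    have h0 : ∀ x ∈ Icc ε (1 - ε), x ≠ 0 := fun x hx => by linarith [hx.1]
    have h2 : ContinuousOn (fun x : ℝ => 1 - x) (Icc ε (1 - ε)) := by fun_prop
    have h3 := (h2.log h1).sub (continuousOn_const (c := Real.log (1 - ε)))
  · exact (continuousOn_const.div continuousOn_id h0).mul h3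
  · exact (continuousOn_const.div h2 h1).mul h3

section Hol
variable {R : Type w} [CommRing R] [Algebra ℂ R] {C : Type u} [ChCat.{w, u, v} R C]
  {S : SymStrictMonoidal R C} (t : S.Inf2Braiding)

/-- With `x = c_I(s)` and `ĉ_V = -x / (1 - x)`, one has `dĉ_V / ĉ_V = dx / x + dx / (1 - x)` and
`dĉ_V / (ĉ_V - 1) = dx / (1 - x)`. -/
theorem hol2_twoPathV {a : ℂ} (ha : a ≠ 0) {ε : ℝ} (hε : 0 < ε) (hε' : ε ≤ 1 / 4) :
    (cmkzZV t).hol2 (twoPathV a ε) 2 =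
      ((dilogInt ε + logSqInt ε : ℝ) : ℂ) • relL t + (logSqInt ε : ℂ) • relR t := by
  refine hol2_two_eq t (I := ![((dilogInt ε + logSqInt ε : ℝ) : ℂ), (logSqInt ε : ℂ)])
    fun k => ?_
  refine (integral_twoPathDiag t k ha hε hε' (fun s h0 h1 => hasDerivAt_pathVrev hε hε' h1.le)
    (fun s h0 h1 => pathVrev_ne_zero hε hε' h0.le h1.le)
    (fun s h0 h1 => pathVrev_ne_one hε hε' h1.le)).trans ?_
  fin_cases k
  · refine Eq.trans (integral_zero_one_congr fun s h0 h1 => ?_) (integral_pathI_dilogInt hε hε')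
    have n0 := ofReal_pathI_ne_zero hε hε' h0.le
    have n1 := one_sub_ofReal_pathI_ne_zero hε hε' h1.le
    have n2 := pathVrev_ne_zero hε hε' h0.le h1.le
    have e : pathVrev ε s = -(pathI ε s : ℂ) / (1 - (pathI ε s : ℂ)) := by
      rw [pathVrev]
      field_simp
      ring
    simp only [Nat.cast_zero, sub_zero]
    rw [e]
    push_cast
    field_simp
    ring
  · refine Eq.trans (integral_zero_one_congr fun s h0 h1 => ?_) (integral_pathI_logSqInt ε)
    have n1 := one_sub_ofReal_pathI_ne_zero hε hε' h1.le
    have e : pathVrev ε s - 1 = -1 / (1 - (pathI ε s : ℂ)) := by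
      rw [pathVrev]
      ring
    simp only [Nat.cast_one]
    rw [e]
    push_cast
    field_simp

/-- The reflection `z ↦ 1 - z` takes `ĉ_V` to `c_III` and exchanges the poles `0` and `1`, so the
coefficients of `P_V` are interchanged. -/
theorem hol2_twoPathIII {a : ℂ} (ha : a ≠ 0) {ε : ℝ} (hε : 0 < ε) (hε' : ε ≤ 1 / 4) :
    (cmkzZV t).hol2 (twoPathIII a ε) 2 =
      (logSqInt ε : ℂ) • relL t + ((dilogInt ε + logSqInt ε : ℝ) : ℂ) • relR t := by
  refine hol2_two_eq t (I := ![(logSqInt ε : ℂ), ((dilogInt ε + logSqInt ε : ℝ) : ℂ)])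
    fun k => ?_
  refine (integral_twoPathDiag t k ha hε hε' (fun s h0 h1 => hasDerivAt_pathIII hε hε' h1.le)
    (fun s h0 h1 => pathIII_ne_zero hε hε' h1.le)
    (fun s h0 h1 => pathIII_ne_one hε hε' h0.le h1.le)).trans ?_
  fin_cases k
  · refine Eq.trans (integral_zero_one_congr fun s h0 h1 => ?_) (integral_pathI_logSqInt ε)
    have n1 := one_sub_ofReal_pathI_ne_zero hε hε' h1.le
    simp only [Nat.cast_zero, sub_zero]
    rw [pathIII]
    push_cast
    field_simp
  · refine Eq.trans (integral_zero_one_congr fun s h0 h1 => ?_) (integral_pathI_dilogInt hε hε')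
    have n0 := ofReal_pathI_ne_zero hε hε' h0.le
    have n1 := one_sub_ofReal_pathI_ne_zero hε hε' h1.le
    have e : pathIII ε s - 1 = (pathI ε s : ℂ) / (1 - (pathI ε s : ℂ)) := by
      rw [pathIII]
      field_simp
      ring
    simp only [Nat.cast_one]
    rw [e]
    push_cast
    field_simp
    ring

/-- Since `Ω₁ = -dx / (1 - x)`, a primitive is `log (1 - x)`: the inner iterated integral is exactly
the height factor of the 2-paths. -/
theorem iterInt_Omega_one {ε x : ℝ} (hε : 0 < ε) (hx : ε ≤ x)
    (hx' : x ≤ 1 - ε) : iterInt [Omega 1] ε x = (logRatio ε x : ℂ) := by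
  have hlt : ∀ y ∈ uIcc ε x, y < 1 := fun y hy => by
    rw [uIcc_of_le hx] at hy
    linarith [hy.2]
  have e : ∀ y : ℝ, Omega 1 y * 1 = ((-(1 / (1 - y)) : ℝ) : ℂ) := fun y => by
    rw [Omega, if_neg one_ne_zero, ← neg_sub (1 : ℂ) y]
    push_cast
    rw [div_neg, mul_one]
  simp only [iterInt, e]
  rw [intervalIntegral.integral_ofReal, intervalIntegral.integral_eq_sub_of_hasDerivAt
    (fun y hy => hasDerivAt_log_one_sub (hlt y hy)), logRatio]
  apply ContinuousOn.intervalIntegrable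
  exact (continuousOn_const.div (by fun_prop) fun y hy => (sub_pos.2 (hlt y hy)).ne').neg

theorem iterInt_Omega_zero_one {ε : ℝ} (hε : 0 < ε) (hε' : ε ≤ 1 / 4) :
    iterInt [Omega 0, Omega 1] ε (1 - ε) = (dilogInt ε : ℂ) := by
  rw [iterInt, dilogInt, ← intervalIntegral.integral_ofReal]
  refine intervalIntegral.integral_congr fun x hx => ?_
  rw [uIcc_of_le (by linarith)] at hx
  simp only [iterInt_Omega_one hε hx.1 hx.2, Omega, if_true]
  push_cast
  rfl

/-- The sign is that of the outer form `Ω₁ = -dx / (1 - x)`. -/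
theorem iterInt_Omega_one_one {ε : ℝ} (hε : 0 < ε) (hε' : ε ≤ 1 / 4) :
    iterInt [Omega 1, Omega 1] ε (1 - ε) = -(logSqInt ε : ℂ) := by
  rw [iterInt, logSqInt, ← intervalIntegral.integral_ofReal, ← intervalIntegral.integral_neg]
  refine intervalIntegral.integral_congr fun x hx => ?_
  rw [uIcc_of_le (by linarith)] at hx
  simp only [iterInt_Omega_one hε hx.1 hx.2]
  rw [Omega, if_neg one_ne_zero, ← neg_sub (1 : ℂ) x]
  push_cast
  rw [div_neg, neg_mul]

theorem sandwich_zero_zero (Ξ : ModTo0 S.tensor2) : sandwich t 0 0 Ξ = Ξ :=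
  (ModTo0.whiskR_one _).trans (ModTo0.whiskL_one _)

/-- Only `q = 0`, `k = 1`, `j = 0` has order two. In the definition of `fV` the second index `m.2`
is `k - 1`, so a single `Ω₁` follows `Ω₀`. -/
theorem fV_two {ε : ℝ} (hε : 0 < ε) (hε' : ε ≤ 1 / 4) :
    fV t ε 1 2 = ((dilogInt ε + logSqInt ε : ℝ) : ℂ) • relL t + (logSqInt ε : ℂ) • relR t := by
  have h : fV t ε 1 2 = iterInt [Omega 0, Omega 1] ε (pathI ε 1) • relL t -
      iterInt [Omega 1, Omega 1] ε (pathI ε 1) • (relL t + relR t) := by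
    simp [fV, sandwich_zero_zero]
  rw [h, pathI_one, iterInt_Omega_zero_one hε hε', iterInt_Omega_one_one hε hε']
  push_cast
  module

theorem hasDerivAt_pathIV (ε s : ℝ) :
    HasDerivAt (pathIV ε) ((1 / (ε : ℂ) - 1 / 2) *
      (Complex.exp (-(Complex.I * Real.pi * s)) * -(Complex.I * Real.pi))) s := by
  have h := ((Complex.ofRealCLM.hasDerivAt (x := s)).const_mul (Complex.I * Real.pi)).fun_neg
  simp only [Complex.ofRealCLM_apply, Complex.ofReal_one, mul_one] at h
  exact ((h.cexp).const_mul _).const_add _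

theorem pathIV_eq (ε s : ℝ) : pathIV ε s =
    ((1 / 2 + (1 / ε - 1 / 2) * Real.cos (Real.pi * s) : ℝ) : ℂ) -
      ((1 / ε - 1 / 2) * Real.sin (Real.pi * s) : ℝ) * Complex.I := by
  have e : -(Complex.I * Real.pi * s) = ((-(Real.pi * s) : ℝ) : ℂ) * Complex.I := by
    push_cast
    ring
  rw [pathIV, e, Complex.exp_mul_I, ← Complex.ofReal_cos, ← Complex.ofReal_sin, Real.cos_neg,
    Real.sin_neg]
  push_cast
  ring

/-- The curve joins a point right of `[0, 1]` to one left of it through the lower half-plane.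
Multiplication by `i` rotates that half-plane to the right half-plane and sends the two ends to
nonzero points of the imaginary axis, so the principal logarithm is regular along the closed curve.
-/
theorem I_mul_pathIV_sub_mem_slitPlane {ε s d : ℝ} (hε : 0 < ε) (hε' : ε ≤ 1 / 4)
    (hs : s ∈ Icc (0 : ℝ) 1) (hd : 0 ≤ d) (hd' : d ≤ 1) :
    Complex.I * (pathIV ε s - d) ∈ Complex.slitPlane := by
  -- This places the endpoints `1 / ε` and `1 - 1 / ε` of the curve outside `[0, 1]`.
  have h4 : 4 ≤ 1 / ε := by
    rw [le_div_iff₀ hε]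
    linarith
  rw [Complex.mem_slitPlane_iff, pathIV_eq]
  simp only [Complex.mul_re, Complex.mul_im, Complex.I_re, Complex.I_im, Complex.sub_re,
    Complex.sub_im, Complex.ofReal_re, Complex.ofReal_im, mul_zero, mul_one,
    zero_mul, one_mul, zero_sub, sub_zero, add_zero, zero_add]
  rcases hs.1.eq_or_lt with rfl | h0
  · right
    rw [mul_zero, Real.cos_zero]
    linarith
  · rcases hs.2.eq_or_lt with rfl | h1
    · right
      rw [mul_one, Real.cos_pi]
      linarith
    · left
      have hp := Real.pi_pos
      have := Real.sin_pos_of_pos_of_lt_pi (mul_pos hp h0) (by nlinarith)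
      have := mul_pos (show 0 < 1 / ε - 1 / 2 by linarith) this
      linarith

theorem pathIV_sub_ne_zero {ε s d : ℝ} (hε : 0 < ε) (hε' : ε ≤ 1 / 4)
    (hs : s ∈ Icc (0 : ℝ) 1) (hd : 0 ≤ d) (hd' : d ≤ 1) : pathIV ε s - d ≠ 0 := fun h =>
  Complex.slitPlane_ne_zero (I_mul_pathIV_sub_mem_slitPlane hε hε' hs hd hd') (by rw [h, mul_zero])

/-- The primitive `log (i (c - d))` has argument `π / 2` at the start and `-π / 2` at the end, which
gives `-iπ`; the moduli give the real part, in which the two `log ε` cancel. -/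
theorem integral_dlog_pathIV {ε d : ℝ} (hε : 0 < ε) (hε' : ε ≤ 1 / 4) (hd : 0 ≤ d) (hd' : d ≤ 1) :
    ∫ s in (0 : ℝ)..1, (1 / (ε : ℂ) - 1 / 2) *
      (Complex.exp (-(Complex.I * Real.pi * s)) * -(Complex.I * Real.pi)) / (pathIV ε s - d) =
      ((Real.log (1 - ε + d * ε) - Real.log (1 - d * ε) : ℝ) : ℂ) - Real.pi * Complex.I := by
  have hder : ∀ s ∈ uIcc (0 : ℝ) 1, HasDerivAt (fun s => Complex.log (Complex.I * (pathIV ε s - d)))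
      ((1 / (ε : ℂ) - 1 / 2) * (Complex.exp (-(Complex.I * Real.pi * s)) * -(Complex.I * Real.pi)) /
        (pathIV ε s - d)) s := by
    intro s hs
    rw [uIcc_of_le zero_le_one] at hs
    have h := (((hasDerivAt_pathIV ε s).sub_const (d : ℂ)).const_mul Complex.I).clog_real
      (I_mul_pathIV_sub_mem_slitPlane hε hε' hs hd hd')
    -- The rotation by `i` does not change the logarithmic derivative.
    rwa [mul_div_mul_left _ _ Complex.I_ne_zero] at h
  rw [intervalIntegral.integral_eq_sub_of_hasDerivAt hder]
  · have hp : 0 < 1 - ε + d * ε := by nlinarith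
    have hq : 0 < 1 - d * ε := by nlinarith
    have e0 : Complex.I * (pathIV ε 0 - d) = (((1 - d * ε) / ε : ℝ) : ℂ) * Complex.I := by
      have : (ε : ℂ) ≠ 0 := by exact_mod_cast hε.ne'
      rw [pathIV_eq]
      simp only [mul_zero, Real.cos_zero, Real.sin_zero]
      push_cast
      field_simp
      ring
    have e1 : Complex.I * (pathIV ε 1 - d) =
        (((1 - ε + d * ε) / ε : ℝ) : ℂ) * -Complex.I := by
      have : (ε : ℂ) ≠ 0 := by exact_mod_cast hε.ne'
      rw [pathIV_eq]
      simp only [mul_one, Real.cos_pi, Real.sin_pi]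
      push_cast
      field_simp
      ring
    rw [e0, e1, Complex.log_ofReal_mul (div_pos hq hε) Complex.I_ne_zero,
      Complex.log_ofReal_mul (div_pos hp hε) (neg_ne_zero.2 Complex.I_ne_zero), Complex.log_I,
      Complex.log_neg_I, Real.log_div hp.ne' hε.ne', Real.log_div hq.ne' hε.ne']
    push_cast
    ring
  · apply ContinuousOn.intervalIntegrable
    rw [uIcc_of_le zero_le_one]
    refine ContinuousOn.div (by fun_prop) ?_ fun s hs => pathIV_sub_ne_zero hε hε' hs hd hd'
    unfold pathIV
    fun_prop

/-- The constant height factor is `log ε - log (1 - ε)`; it multiplies `integral_dlog_pathIV` at `d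
= 0` and `d = 1`. -/
theorem hol2_twoPathIV {a : ℂ} (ha : a ≠ 0) {ε : ℝ} (hε : 0 < ε) (hε' : ε ≤ 1 / 4) :
    (cmkzZV t).hol2 (twoPathIV a ε) 2 =
      (((Real.log (1 - ε) : ℂ) - Real.pi * Complex.I) *
        (Real.log ε - Real.log (1 - ε) : ℝ)) • relL t +
      ((-(Real.log (1 - ε) : ℂ) - Real.pi * Complex.I) *
        (Real.log ε - Real.log (1 - ε) : ℝ)) • relR t := by
  have hl : logRatio ε (1 - ε) = Real.log ε - Real.log (1 - ε) := by
    rw [logRatio, sub_sub_cancel]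
  refine hol2_two_eq t (I := ![((Real.log (1 - ε) : ℂ) - Real.pi * Complex.I) *
      (Real.log ε - Real.log (1 - ε) : ℝ), (-(Real.log (1 - ε) : ℂ) - Real.pi * Complex.I) *
      (Real.log ε - Real.log (1 - ε) : ℝ)]) fun k => ?_
  rw [integral_twoPathIV t k ha hε hε' (hasDerivAt_pathIV ε)
    (fun s h0 h1 => by
      simpa using pathIV_sub_ne_zero hε hε' ⟨h0.le, h1.le⟩ le_rfl zero_le_one)
    (fun s h0 h1 => by
      simpa [sub_eq_zero] using pathIV_sub_ne_zero hε hε' ⟨h0.le, h1.le⟩ zero_le_one le_rfl), hl]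
  fin_cases k
  · have h := integral_dlog_pathIV hε hε' le_rfl zero_le_one
    simp only [Complex.ofReal_zero, zero_mul, add_zero, sub_zero, Real.log_one] at h
    simp only [Fin.zero_eta, Nat.cast_zero, sub_zero]
    rw [h]
    rfl
  · have h := integral_dlog_pathIV hε hε' zero_le_one le_rfl
    simp only [Complex.ofReal_one, one_mul, sub_add_cancel, Real.log_one, zero_sub,
      Complex.ofReal_neg] at h
    simp only [Fin.mk_one, Nat.cast_one]
    rw [h]
    rfl

end Hol

/-- Only two fixed vectors occur, so continuity of addition and of scalar multiplication reduces the
convergence to that of the scalar coefficients. -/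
theorem tendsto_moduleTopology_zero {α M : Type*} [AddCommGroup M] [Module ℂ M] {l : Filter α}
    {f g : α → ℂ} (hf : Tendsto f l (𝓝 0)) (hg : Tendsto g l (𝓝 0)) (x y : M) {h : α → M}
    (hh : ∀ᶠ i in l, f i • x + g i • y = h i) :
    Tendsto h l (@nhds _ (moduleTopology ℂ M) 0) := by
  let _ : TopologicalSpace M := moduleTopology ℂ M
  have : ContinuousSMul ℂ M := ModuleTopology.continuousSMul ℂ M
  have : ContinuousAdd M := ModuleTopology.continuousAdd ℂ M
  have := (hf.smul_const x).add (hg.smul_const y)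
  simp only [zero_smul, add_zero] at this
  exact this.congr' hh

end PathIntegrals

theorem mainTheorem5 {R : Type w} [CommRing R] [Algebra ℂ R] {C : Type u} [ChCat.{w, u, v} R C]
    (S : SymStrictMonoidal R C) (t : S.Inf2Braiding) (hsym : SymStrictMonoidal.IsSymmetric t)
    (hstrict : SymStrictMonoidal.IsStrict t) (a : ℂ) (ha : a ≠ 0) :
    let L : ModTo0 S.tensor2 := SymStrictMonoidal.relL t
    let R' : ModTo0 S.tensor2 := SymStrictMonoidal.relR t
    let WV : ℝ → ℕ → ModTo0 S.tensor2 := fun ε => (cmkzZV t).hol2 (twoPathV a ε)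
    let WIII : ℝ → ℕ → ModTo0 S.tensor2 := fun ε => (cmkzZV t).hol2 (twoPathIII a ε)
    let WIV : ℝ → ℕ → ModTo0 S.tensor2 := fun ε => (cmkzZV t).hol2 (twoPathIV a ε)
    let fV1 : ℝ → ℕ → ModTo0 S.tensor2 := fun ε => fV t ε 1
    let Null : (ℝ → ModTo0 S.tensor2) → Prop := fun g =>
      Filter.Tendsto g (𝓝[>] 0) (@nhds _ (moduleTopology ℂ (ModTo0 S.tensor2)) 0)
    (∀ ε : ℝ, 0 < ε → ε ≤ 1 / 4 → ∀ n < 2,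
      WV ε n = 0 ∧ fV1 ε n = 0 ∧ WIII ε n = 0 ∧ WIV ε n = 0) ∧
    Null (fun ε => WV ε 2 - (-((Real.pi ^ 2 / 6 : ℝ) : ℂ) • L -
      ((Real.log ε ^ 2 / 2 : ℝ) : ℂ) • (L + R'))) ∧
    Null (fun ε => fV1 ε 2 - (-((Real.pi ^ 2 / 6 : ℝ) : ℂ) • L -
      ((Real.log ε ^ 2 / 2 : ℝ) : ℂ) • (L + R'))) ∧
    Null (fun ε => WIII ε 2 - (-((Real.pi ^ 2 / 6 : ℝ) : ℂ) • R' -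
      ((Real.log ε ^ 2 / 2 : ℝ) : ℂ) • (L + R'))) ∧
    Null (fun ε => WIV ε 2 -
      (-(Complex.I * (Real.pi : ℂ) * (Real.log ε : ℂ))) • (L + R')) := by
  intro L R' WV WIII WIV fV1 Null
  -- `t1` is the error of a coefficient `logSqInt`, and `t2` that of a coefficient `dilogInt +
  -- logSqInt`. The latter belongs to `𝓛` for `P_V` and `f_V`, and to `𝓡` for `P_III`.
  have t1 := Filter.Tendsto.ofReal tendsto_logSqInt
  have t2 := Filter.Tendsto.ofReal (tendsto_dilogInt.add tendsto_logSqInt)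
  rw [add_zero] at t2
  rw [Complex.ofReal_zero] at t1 t2
  refine ⟨fun ε _ _ n hn => ?_, ?_, ?_, ?_, ?_⟩
  · interval_cases n
    · exact ⟨rfl, rfl, rfl, rfl⟩
    · exact ⟨rfl, rfl, rfl, rfl⟩
  · refine tendsto_moduleTopology_zero t2 t1 L R' (eventually_small.mono fun ε hε => ?_)
    simp only [WV, hol2_twoPathV t ha hε.1 hε.2, L, R']
    push_cast
    module
  · refine tendsto_moduleTopology_zero t2 t1 L R' (eventually_small.mono fun ε hε => ?_)
    simp only [fV1, fV_two t hε.1 hε.2, L, R']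
    push_cast
    module
  · refine tendsto_moduleTopology_zero t1 t2 L R' (eventually_small.mono fun ε hε => ?_)
    simp only [WIII, hol2_twoPathIII t ha hε.1 hε.2, L, R']
    push_cast
    module
  · have h1 := Filter.Tendsto.ofReal tendsto_log_one_sub
    have h2 := Filter.Tendsto.ofReal
      (tendsto_log_mul_log_one_sub.sub (tendsto_log_one_sub.mul tendsto_log_one_sub))
    simp only [mul_zero, sub_zero, Complex.ofReal_zero] at h1 h2
    have h3 := h1.const_mul ((Real.pi : ℂ) * Complex.I)
    rw [mul_zero] at h3
    -- After adding `iπ log ε`, the coefficients of `𝓛` and `𝓡` leave the remainders `iπ log (1 - ε)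
    -- ± (log ε · log (1 - ε) - log (1 - ε)²)`.
    have k1 := h2.add h3
    have k2 := h3.sub h2
    rw [add_zero] at k1
    rw [sub_zero] at k2
    refine tendsto_moduleTopology_zero k1 k2 L R' (eventually_small.mono fun ε hε => ?_)
    simp only [WIV, hol2_twoPathIV t ha hε.1 hε.2, L, R']
    push_cast
    module
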